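/- **Setting.** Let $\mathcal X,\mathcal A$ be countable and let $M^\star$ be an episodic MDP with horizon $H$, initial distribution $d_1$, transitions $P_h(\cdot\mid x,a)$, and reward distributions $R_h(x,a)$ on $[0,1]$, such that $\sum_{h=1}^H r_h\in[0,1]$ almost surely under every policy. Write $J(\pi)=\mathbb E^\pi[\sum_h r_h]$, $d^\pi_h(x,a)=\mathbb P^\pi[x_h=x,a_h=a]$, let $\pi^\star$ be an optimal policy, and let $[\mathcal T_hf](x,a)=\mathbb E[r_h+\max_{a'}f(x_{h+1},a')\mid x_h=x,a_h=a]$. Let $\mathcal F$ be a finite nonempty class of functions $f=(f_1,\dots,f_H)$, $f_h:\mathcal X\times\mathcal A\to[0,1]$, with $\mathcal F_h=\{f_h: f\in\mathcal F\}$, $\mathcal F_{H+1}=\{0\}$. For every $f\in\mathcal F_1\times\dots\times\mathcal F_H$ assume that a greedy policy $\pi_{f,h}(x)\in\arg\max_a f_h(x,a)$ exists and fix one (ties broken arbitrarily, as a function of $f$), and let $\Pi=\{\pi_f: f_h\in\mathcal F_h\ \forall h\}$. *Bellman completeness* means $\mathcal T_h\mathcal F_{h+1}\subseteq\mathcal F_h$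 for all $h\in[H]$. Density ratios use $x/0=\infty$ for $x>0$ and $0/0=1$. For distributions $\mu_h$ on $\mathcal X\times\mathcal A$ and $c>0$ let $$\mathsf{CC}_h(\pi,\mu,c)=\mathbb E_{(x,a)\sim d^\pi_h}\Big[\min\Big\{\tfrac{d^\pi_h(x,a)}{\mu_h(x,a)},\,c\Big\}\Big],\qquad C_{\mathsf{cov}}=\inf_{\mu_1,\dots,\mu_H}\ \sup_{\pi\in\Pi,\,h\in[H]}\Big\|\tfrac{d^\pi_h}{\mu_h}\Big\|_\infty .$$ A dataset of $H\cdot n$ samples from adaptively chosen data distributions $\mu^{(1)},\dots,\mu^{(n)}$ consists of transitions $(x_h^{(i)},a_h^{(i)},r_h^{(i)},x_{h+1}^{(i)})$ such that, for each $h$ and conditionally on the samples of rounds before $i$, $(x_h^{(i)},a_h^{(i)})\sim\mu^{(i)}_h$, $r_h^{(i)}\sim R_h$, $x_{h+1}^{(i)}\sim P_h$, where $\mu^{(i)}$ may depend on the earlier rounds; transitions of different layers in one round may be dependent. Put $\mu^{(1:n)}_h=\frac1n\sum_i\mu^{(i)}_h$. *Fitted Q-Iteration* (FQI) sets $\hat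 f_{H+1}=0$ and, for $h=H,\dots,1$, takes any $\hat f_h\in\arg\min_{f_h\in\mathcal F_h}\frac1n\sum_{i=1}^n\big(f_h(x_h^{(i)},a_h^{(i)})-r_h^{(i)}-\max_{a'}\hat f_{h+1}(x_{h+1}^{(i)},a')\big)^2$; it outputs $\hat\pi=\pi_{\hat f}$. **Theorem.** 1. (*FQI is $\mathsf{CC}$-bounded for all $\gamma>0$ simultaneously, with $\mathfrak a_\gamma=6/\gamma$ and $\mathfrak b_\gamma=1024\log(2\min\{n,H\}|\mathcal F|/\delta)\,\gamma$.*) Let $\delta\in(0,1)$ and $n\ge1$, and assume Bellman completeness. With probability at least $1-\delta$ over a dataset of $H\cdot n$ samples from adaptively chosen $\mu^{(1)},\dots,\mu^{(n)}$, the output $\hat\pi\in\Pi$ of FQI satisfies, for all $\gamma>0$ simultaneously, $$J(\pi^\star)-J(\hat\pi)\ \le\ \sum_{h=1}^H\Big[\frac{6}{\gamma n}\Big(\mathsf{CC}_h(\pi^\star,\mu^{(1:n)},\gamma n)+\mathsf{CC}_h(\hat\pi,\mu^{(1:n)},\gamma n)\Big)+1024\,\log\!\Big(\frac{2\min\{n,H\}\,|\mathcal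 F|}{\delta}\Big)\gamma\Big].$$ 2. (*Risk of $\mathrm{H_2O}$ with FQI.*) There are universal constants $C,k$ such that the following holds. Let $\delta\in(0,1)$, $T\ge1$, assume Bellman completeness, and let $\nu=(\nu_h)_h$ satisfy $\max_h\|d^{\pi^\star}_h/\nu_h\|_\infty\le C_\star$. Given an offline dataset consisting, in each layer, of $T$ samples from $\nu$ (independent over the $T$ rounds), $\mathrm{H_2O}$ runs FQI in each round $t=1,\dots,T$ on the first $t-1$ offline samples together with the $t-1$ online episodes collected so far, obtains $\pi^{(t)}$, and collects a new episode with $\pi^{(t)}$; it outputs $\mathrm{Unif}(\pi^{(1)},\dots,\pi^{(T)})$. With probability at least $1-\delta T$, $$\mathrm{Risk}=\frac1T\sum_{t=1}^T\big(J(\pi^\star)-J(\pi^{(t)})\big)\ \le\ C\,\log^k(eHT)\; H\sqrt{\frac{(C_\star+C_{\mathsf{cov}})\log(|\mathcal F|/\delta)}{T}} .$$ -/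

import Mathlib

open MeasureTheory ProbabilityTheory
open scoped ENNReal

universe u v w

namespace HybridRL

noncomputable section

/-- One observed transition `(x_h, a_h, r_h, x_{h+1})`. -/
abbrev Sample (X : Type u) (A : Type v) : Type (max u v) := X × A × ℝ × X

/-- A (randomized, nonstationary) policy. Layers `1, …, H` are indexed by `Fin H`. -/
abbrev Policy (H : ℕ) (X : Type u) (A : Type v) : Type (max u v) := Fin H → X → PMF A

/-- A value function `f = (f_1, …, f_H)`. -/
abbrev QFun (H : ℕ) (X : Type u) (A : Type v) : Type (max u v) := Fin H → X → A → ℝ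

/-- A dataset with `n` transitions for each of the `H` layers. -/
abbrev Dataset (H n : ℕ) (X : Type u) (A : Type v) : Type (max u v) := Fin n → Fin H → Sample X A

/-- An offline RL algorithm: a map from datasets of arbitrary size to policies. -/
abbrev OfflineAlg (H : ℕ) (X : Type u) (A : Type v) : Type (max u v) :=
  (n : ℕ) → Dataset H n X A → Policy H X A

/-- The policy that plays the action `g h x` in state `x` at layer `h`. -/
def detPolicy {H : ℕ} {X : Type u} {A : Type v} (g : Fin H → X → A) : Policy H X A :=
  fun h x => PMF.pure (g h x)

/-- An episodic MDP with horizon `H`, stochastic rewards in `[0, 1]`. The state following the last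
layer, drawn from the last transition kernel, plays no role for values. -/
structure MDP (H : ℕ) (X : Type u) (A : Type v) where
  /-- initial state distribution -/
  init : PMF X
  /-- transition distributions -/
  P : Fin H → X → A → PMF X
  /-- reward distributions -/
  R : Fin H → X → A → Measure ℝ
  R_prob : ∀ h x a, IsProbabilityMeasure (R h x a)
  R_mem : ∀ h x a, ∀ᵐ r ∂(R h x a), r ∈ Set.Icc (0 : ℝ) 1

section Law

variable {X : Type u} {A : Type v} [MeasurableSpace X] [MeasurableSpace A]

/-- Law of the transitions of an `n`-layer episode started in state `x`: draw `a ∼ π_1(x)`,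
`r ∼ R_1(x, a)` and `x' ∼ P_1(x, a)`, then continue from `x'` with the remaining layers. -/
def trajFrom : (n : ℕ) → (Fin n → X → A → PMF X) → (Fin n → X → A → Measure ℝ) →
    (Fin n → X → PMF A) → X → Measure (Fin n → Sample X A)
  | 0, _, _, _, _ => Measure.dirac (fun i => i.elim0)
  | n + 1, P, R, π, x =>
      (π 0 x).toMeasure.bind fun a =>
        ((R 0 x a).prod (P 0 x a).toMeasure).bind fun q =>
          (trajFrom n (fun h => P h.succ) (fun h => R h.succ) (fun h => π h.succ) q.2).map
            (fun τ => (Fin.cons (x, a, q.1, q.2) τ : Fin (n + 1) → Sample X A))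

variable {H : ℕ} (M : MDP H X A)

/-- `ℙ^π`, the law of the episode generated by the policy `π`. -/
def MDP.law (π : Policy H X A) : Measure (Fin H → Sample X A) :=
  M.init.toMeasure.bind (trajFrom H M.P M.R π)

/-- `J(π)`, the expected total reward. -/
def MDP.J (π : Policy H X A) : ℝ := ∫ τ, ∑ h, (τ h).2.2.1 ∂(M.law π)

/-- The occupancy measure `d_h^π(x, a) = ℙ^π[x_h = x, a_h = a]`. -/
def MDP.occ (π : Policy H X A) (h : Fin H) (z : X × A) : ℝ≥0∞ :=
  M.law π {τ | ((τ h).1, (τ h).2.1) = z}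

/-- The total reward of an episode lies in `[0, 1]` almost surely, whatever the policy. -/
def MDP.Normalized : Prop :=
  ∀ π : Policy H X A, ∀ᵐ τ ∂(M.law π), ∑ h, (τ h).2.2.1 ∈ Set.Icc (0 : ℝ) 1

/-- `πs` is an optimal policy. -/
def MDP.IsOptimal (πs : Policy H X A) : Prop := ∀ π : Policy H X A, M.J π ≤ M.J πs

/-- Law of a transition at layer `h`: `(x, a) ∼ q`, `r ∼ R_h(x, a)`, `x' ∼ P_h(x, a)`. -/
def MDP.sampleLaw (h : Fin H) (q : PMF (X × A)) : Measure (Sample X A) :=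
  q.toMeasure.bind fun z =>
    ((M.R h z.1 z.2).prod (M.P h z.1 z.2).toMeasure).map fun p => (z.1, z.2, p.1, p.2)

/-- The Bellman optimality operator
`[T_h f](x, a) = 𝔼[r_h + max_{a'} f(x_{h+1}, a') | x_h = x, a_h = a]`. -/
def MDP.bellman (h : Fin H) (f : X → A → ℝ) (x : X) (a : A) : ℝ :=
  ∫ q, (q.1 + ⨆ a', f q.2 a') ∂((M.R h x a).prod (M.P h x a).toMeasure)

end Law

section Coverage

variable {X : Type u} {A : Type v}

/-- The density ratio `d / m` with the conventions `x / 0 = ∞` for `x > 0` and `0 / 0 = 1`. -/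
def ratio (d m : ℝ≥0∞) : ℝ≥0∞ := if d = 0 ∧ m = 0 then 1 else d / m

/-- The clipped concentrability coefficient `‖clip_c[d / m]‖_{1, d}` at scale `c`, where
`clip_c[w] = min(w, c)`. -/
def ccc (d m : X × A → ℝ≥0∞) (c : ℝ) : ℝ :=
  (∑' z, d z * min (ratio (d z) (m z)) (ENNReal.ofReal c)).toReal

/-- The mixture `μ^{1:n}_h = (1 / n) ∑_i μ^i_h` of data distributions. -/
def mixture {H n : ℕ} (μ : Fin n → Fin H → PMF (X × A)) (h : Fin H) (z : X × A) : ℝ≥0∞ :=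
  (∑ i, μ i h z) / n

/-- The coverability coefficient
`inf_{μ_1, …, μ_H} sup_{π ∈ Π, h} ‖d_h^π / μ_h‖_∞` of a policy class. -/
def MDP.cov [MeasurableSpace X] [MeasurableSpace A] {H : ℕ} (M : MDP H X A)
    (Pol : Set (Policy H X A)) : ℝ≥0∞ :=
  ⨅ μ : Fin H → PMF (X × A), ⨆ π ∈ Pol, ⨆ h, ⨆ z, ratio (M.occ π h z) (μ h z)

/-- `C`-single-policy concentrability: `max_h ‖d_h^{π⋆} / ν_h‖_∞ ≤ C`. -/
def MDP.Concentrable [MeasurableSpace X] [MeasurableSpace A] {H : ℕ} (M : MDP H X A)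
    (πs : Policy H X A) (ν : Fin H → PMF (X × A)) (C : ℝ) : Prop :=
  ∀ h z, ratio (M.occ πs h z) (ν h z) ≤ ENNReal.ofReal C

end Coverage

section Offline

variable {H : ℕ} {X : Type u} {A : Type v} [MeasurableSpace X] [MeasurableSpace A]

/-- `z` consists of `H · n` samples from adaptively chosen data distributions `μ^1, …, μ^n`: given
the past, the `i`-th transition of layer `h` has law `(x, a) ∼ μ^i_h`, `r ∼ R_h(x, a)`,
`x' ∼ P_h(x, a)`. The transitions of different layers within a round may be dependent (for instance
come from one episode). The identity for the conditional law forces `μ^i` to be determined by the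
past, up to null sets. -/
def MDP.IsAdaptiveData (M : MDP H X A) {Ω : Type w} [mΩ : MeasurableSpace Ω] (Pr : Measure Ω)
    {n : ℕ} (μ : Fin n → Ω → Fin H → PMF (X × A)) (z : Fin n → Ω → Fin H → Sample X A) : Prop :=
  ∃ ℱ : Filtration ℕ mΩ,
    (∀ i : Fin n, Measurable[ℱ (i + 1)] (z i)) ∧
    ∀ (i : Fin n) (h : Fin H) (S : Set (Sample X A)), MeasurableSet S →
      Pr[Set.indicator {ω | z i ω h ∈ S} (fun _ => (1 : ℝ)) | ℱ i]
        =ᵐ[Pr] fun ω => (M.sampleLaw h (μ i ω h) S).toReal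

/-- The algorithm `alg`, with outputs in the policy class `Pol`, is CC-bounded under the assumption
`Cond` at all scales `γ ∈ Γ` simultaneously, with scaling functions `𝔞` and `𝔟` and failure
probability `δ`: for every MDP with normalized rewards, every optimal policy, every `n ≥ 1` and all
`H · n` samples from data distributions `μ^1, …, μ^n` whose mixture satisfies `Cond`, outside an
event of probability at most `δ`, for all `γ ∈ Γ`,
`J(π⋆) - J(π̂) ≤ ∑_h [(𝔞_γ / n) (CC_h(π⋆, μ^{1:n}, γ n) + CC_h(π̂, μ^{1:n}, γ n)) + 𝔟_γ]`. -/
def CCBounded (alg : OfflineAlg H X A) (Pol : Set (Policy H X A))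
    (Cond : (Fin H → X × A → ℝ≥0∞) → MDP H X A → Prop)
    (Γ : Set ℝ) (𝔞 : ℝ → ℝ) (𝔟 : ℕ → ℝ → ℝ) (δ : ℝ) : Prop :=
  (∀ n D, alg n D ∈ Pol) ∧
  ∀ (M : MDP H X A) (πs : Policy H X A), M.Normalized → M.IsOptimal πs →
  ∀ (Ω : Type w) [MeasurableSpace Ω] (Pr : Measure Ω) [IsProbabilityMeasure Pr]
    (n : ℕ) (μ : Fin n → Ω → Fin H → PMF (X × A)) (z : Fin n → Ω → Fin H → Sample X A),
    0 < n → M.IsAdaptiveData Pr μ z → (∀ᵐ ω ∂Pr, Cond (mixture fun i => μ i ω) M) →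
    Pr {ω | ¬ ∀ γ ∈ Γ,
        M.J πs - M.J (alg n fun i => z i ω) ≤
          ∑ h, (𝔞 γ / n *
              (ccc (M.occ πs h) (mixture (fun i => μ i ω) h) (γ * n) +
                ccc (M.occ (alg n fun i => z i ω) h) (mixture (fun i => μ i ω) h) (γ * n)) +
            𝔟 n γ)}
      ≤ ENNReal.ofReal δ

end Offline

section FQI

variable {H : ℕ} {X : Type u} {A : Type v}

/-- `f_{h+1}`, with the convention `f_{H+1} = 0`. -/
def nextQ (f : QFun H X A) (h : Fin H) : X → A → ℝ :=
  if hh : h.val + 1 < H then f ⟨h.val + 1, hh⟩ else fun _ _ => 0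

/-- `f_h ∈ F_h = {g_h | g ∈ F}` for all layers `h`. -/
def Layerwise (F : Finset (QFun H X A)) (f : QFun H X A) : Prop := ∀ h, ∃ g ∈ F, g h = f h

/-- `sel` selects, for every `f` with `f_h ∈ F_h` for all `h`, a greedy policy `π_f`,
`π_{f,h}(x) ∈ argmax_a f_h(x, a)`; ties are broken arbitrarily, as a function of `f`. -/
def IsGreedySelector (F : Finset (QFun H X A)) (sel : QFun H X A → Fin H → X → A) : Prop :=
  ∀ f, Layerwise F f → ∀ h x a, f h x a ≤ f h x (sel f h x)

/-- The class of greedy policies `π_f`, `f_h ∈ F_h` for all `h`. -/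
def policyClass (F : Finset (QFun H X A)) (sel : QFun H X A → Fin H → X → A) :
    Set (Policy H X A) :=
  {π | ∃ f, Layerwise F f ∧ π = detPolicy (sel f)}

/-- Bellman completeness: `T_h F_{h+1} ⊆ F_h` for all `h`, where `F_{H+1} = {0}`. -/
def BellmanComplete [MeasurableSpace X] [MeasurableSpace A] (F : Finset (QFun H X A))
    (M : MDP H X A) : Prop :=
  ∀ h, ∀ f ∈ F, ∃ g ∈ F, g h = M.bellman h (nextQ f h)

/-- The empirical squared loss
`(1 / n) ∑_i (f(x_h, a_h) - r_h - max_{a'} f'(x_{h+1}, a'))²` over the layer `h` of a dataset. -/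
def sqLoss {n : ℕ} (D : Dataset H n X A) (h : Fin H) (f f' : X → A → ℝ) : ℝ :=
  (∑ i, (f (D i h).1 (D i h).2.1 - (D i h).2.2.1 - ⨆ a', f' (D i h).2.2.2 a') ^ 2) / n

/-- `fh` is a possible outcome of the backward regressions of Fitted Q-Iteration. -/
def IsFQISolution {n : ℕ} (F : Finset (QFun H X A)) (D : Dataset H n X A) (fh : QFun H X A) :
    Prop :=
  Layerwise F fh ∧
    ∀ h, ∀ g ∈ F, sqLoss D h (fh h) (nextQ fh h) ≤ sqLoss D h (g h) (nextQ fh h)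

/-- `alg` is Fitted Q-Iteration with value function class `F`: it outputs the greedy policy of a
solution of the backward regressions (ties in `argmin` are broken arbitrarily). -/
def IsFQI (F : Finset (QFun H X A)) (sel : QFun H X A → Fin H → X → A) (alg : OfflineAlg H X A) :
    Prop :=
  ∀ n (D : Dataset H n X A), ∃ fh, IsFQISolution F D fh ∧ alg n D = detPolicy (sel fh)

end FQI

section H2O

variable {H T : ℕ} {X : Type u} {A : Type v}

/-- The policy of the hybrid-to-offline reduction in round `t`: the output of `alg` on the first
`t` offline samples together with the `t` online episodes collected so far (rounds are numbered
from `0`). -/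
def h2oPolicy (alg : OfflineAlg H X A) (off on : Fin T → Fin H → Sample X A) (t : Fin T) :
    Policy H X A :=
  alg (t + t) (Fin.append (fun i : Fin t => off (Fin.castLE t.isLt.le i))
    (fun i : Fin t => on (Fin.castLE t.isLt.le i)))

/-- `off` and `on` are the data of a run of the hybrid-to-offline reduction with base algorithm
`alg`: `off` consists of `H · T` samples from the data distribution `ν`, independent over the `T`
rounds, and the `t`-th online episode, given the offline data and the earlier episodes, has the law
`ℙ^{π}` of the policy of round `t`. -/
structure MDP.IsH2ORun [MeasurableSpace X] [MeasurableSpace A] (M : MDP H X A)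
    (alg : OfflineAlg H X A) (ν : Fin H → PMF (X × A)) {Ω : Type w} [MeasurableSpace Ω]
    (Pr : Measure Ω) (off on : Fin T → Ω → Fin H → Sample X A) : Prop where
  measurable_off : ∀ t, Measurable (off t)
  measurable_on : ∀ t, Measurable (on t)
  indep_off : iIndepFun off Pr
  law_off : ∀ t h, Pr.map (fun ω => off t ω h) = M.sampleLaw h (ν h)
  law_on : ∀ (t : Fin T) (S : Set (Fin H → Sample X A)), MeasurableSet S →
    Pr[Set.indicator {ω | on t ω ∈ S} (fun _ => (1 : ℝ)) |
        MeasurableSpace.comap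
          (fun ω => ((fun s => off s ω), (fun s : {s : Fin T // s < t} => on s ω))) inferInstance]
      =ᵐ[Pr] fun ω =>
        (M.law (h2oPolicy alg (fun s => off s ω) (fun s => on s ω) t) S).toReal

/-- The risk `J(π⋆) - 𝔼[J(π̂)]` of the output `π̂ = Unif(π^1, …, π^T)` of the reduction. -/
def MDP.h2oRisk [MeasurableSpace X] [MeasurableSpace A] (M : MDP H X A) (πs : Policy H X A)
    (alg : OfflineAlg H X A) (off on : Fin T → Fin H → Sample X A) : ℝ :=
  (∑ t, (M.J πs - M.J (h2oPolicy alg off on t))) / T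

end H2O

end

end HybridRL

open HybridRL

/-! The regret of a greedy policy is controlled by its Bellman errors. Along an episode, the sum of
`f_h(x_h, a_h) - max f_{h+1}(x_{h+1}, ·)` is at most `max f_1(x_1, ·)` under every policy, with
equality under the greedy one. Its expectation is the return plus the expected Bellman errors, and
the law of `x_1` does not depend on the policy. Subtracting bounds the regret by the absolute
Bellman errors under the two occupancies (`MDP.J_sub_le_sum_bellman_error`).

Regression makes these errors small in mean square under the data distributions. The excess squared
loss over the Bellman backup has conditional mean equal to the squared Bellman error `D²`, and size
at most `4|D|`. Its variance is thus of the order of its mean, and a suitably normalised product of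
exponentials has mean at most one even for adaptive data. Markov's inequality gives a fast rate
(`MDP.IsAdaptiveData.measure_sum_sqError`). By completeness the backup competes in the regression,
so the empirical excess loss of FQI is nonpositive. A union bound over triples (layer, regressor,
target) covers the data-dependent choice.

Errors are moved from the data to an occupancy pair by pair (`mul_ofReal_le_clipped`). Where the
density ratio is below the clipping level, AM-GM splits `dΔ` into `d²/m` and `mΔ²`; elsewhere `Δ ≤
1` suffices. The event of the regression bound does not involve `γ`, so all scales hold
simultaneously. The factor `min{n, H}` costs nothing: for `n < H` the right-hand side is at least
one (`one_le_sum_clipped`).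

For the hybrid reduction, the offline half of the data bounds the coefficient of the comparator by
twice its concentrability. The online half contains the earlier occupancies, so the coefficients of
the played policies sum logarithmically by a potential argument with burn-in
(`sum_clipped_potential_le`). This is applied at each pair with the cap given by a covering
distribution (`sum_ccc_hybridLaw_le`). A union bound over rounds and the balancing choice of `γ`
(`risk_le_of_sum_le`) finish the proof. -/

namespace HybridRL

set_option linter.unusedSectionVars false

/-! ### The law of an episode and its one-layer marginals -/

section Trajectory

variable {X : Type u} {A : Type v} [Countable X] [MeasurableSpace X] [DiscreteMeasurableSpace X]
  [Countable A] [MeasurableSpace A] [DiscreteMeasurableSpace A]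

/-- The law of a transition out of the state-action pair `z`. -/
noncomputable def transLaw (R : X → A → Measure ℝ) (P : X → A → PMF X) (z : X × A) :
    Measure (Sample X A) :=
  ((R z.1 z.2).prod (P z.1 z.2).toMeasure).map fun p => (z.1, z.2, p.1, p.2)

lemma measurable_mkSample (z : X × A) :
    Measurable (fun p : ℝ × X => ((z.1, z.2, p.1, p.2) : Sample X A)) := by fun_prop

lemma isProbabilityMeasure_transLaw {R : X → A → Measure ℝ}
    (hR : ∀ x a, IsProbabilityMeasure (R x a)) (P : X → A → PMF X) (z : X × A) :
    IsProbabilityMeasure (transLaw R P z) := by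
  have := hR z.1 z.2
  exact Measure.isProbabilityMeasure_map (measurable_mkSample z).aemeasurable

lemma lintegral_transLaw {R : X → A → Measure ℝ} (P : X → A → PMF X) (z : X × A)
    {φ : Sample X A → ℝ≥0∞} (hφ : Measurable φ) :
    ∫⁻ s, φ s ∂(transLaw R P z)
      = ∫⁻ q, φ (z.1, z.2, q.1, q.2) ∂((R z.1 z.2).prod (P z.1 z.2).toMeasure) :=
  lintegral_map hφ (measurable_mkSample z)

lemma measurable_fin_cons (n : ℕ) :
    Measurable (fun p : Sample X A × (Fin n → Sample X A) =>
      (Fin.cons p.1 p.2 : Fin (n + 1) → Sample X A)) := by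
  refine measurable_pi_iff.2 fun i => ?_
  refine Fin.cases ?_ (fun j => ?_) i
  · simpa using measurable_fst
  · simpa [Function.comp_def] using (measurable_pi_apply j).comp measurable_snd

lemma isProbabilityMeasure_bind {α β : Type*} [MeasurableSpace α] [MeasurableSpace β]
    {m : Measure α} [IsProbabilityMeasure m] {κ : α → Measure β} (hκ : Measurable κ)
    (h : ∀ a, IsProbabilityMeasure (κ a)) : IsProbabilityMeasure (m.bind κ) := by
  constructor
  rw [Measure.bind_apply MeasurableSet.univ hκ.aemeasurable]
  simp

/-- The next state is countable, so only the reward needs an argument: for a fixed next state, the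
measure of a slice of a measurable set depends measurably on the reward. -/
lemma measurable_trajStep {n : ℕ} (κ : X → Measure (Fin n → Sample X A))
    [∀ x, IsProbabilityMeasure (κ x)] (x : X) (a : A) :
    Measurable fun q : ℝ × X =>
      (κ q.2).map fun τ => (Fin.cons (x, a, q.1, q.2) τ : Fin (n + 1) → Sample X A) := by
  refine measurable_from_prod_countable_left fun y => ?_
  refine Measure.measurable_of_measurable_coe _ fun S hS => ?_
  have hm : Measurable fun p : ℝ × (Fin n → Sample X A) =>
      (Fin.cons (x, a, p.1, y) p.2 : Fin (n + 1) → Sample X A) :=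
    (measurable_fin_cons n).comp (by fun_prop :
      Measurable fun p : ℝ × (Fin n → Sample X A) => (((x, a, p.1, y) : Sample X A), p.2))
  have h2 := measurable_measure_prodMk_left (ν := κ y) (hm hS)
  convert h2 using 2 with r
  exact Measure.map_apply (hm.comp measurable_prodMk_left) hS

lemma isProbabilityMeasure_trajFrom (n : ℕ) (P : Fin n → X → A → PMF X)
    (R : Fin n → X → A → Measure ℝ) (hR : ∀ h x a, IsProbabilityMeasure (R h x a))
    (π : Fin n → X → PMF A) (x : X) : IsProbabilityMeasure (trajFrom n P R π x) := by
  induction n generalizing x with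
  | zero => exact Measure.dirac.isProbabilityMeasure
  | succ n ih =>
    have ih' := fun y => ih (fun h => P h.succ) (fun h => R h.succ) (fun h => hR h.succ)
      (fun h => π h.succ) y
    refine isProbabilityMeasure_bind Measurable.of_discrete fun a => ?_
    have := hR 0 x a
    refine isProbabilityMeasure_bind (measurable_trajStep _ x a) fun q => ?_
    exact Measure.isProbabilityMeasure_map
      ((measurable_fin_cons n).comp measurable_prodMk_left).aemeasurable

/-- The one-step unrolling of the recursion; the inductions on the number of layers below rest on
it. -/
lemma lintegral_trajFrom_succ {n : ℕ} (P : Fin (n + 1) → X → A → PMF X)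
    (R : Fin (n + 1) → X → A → Measure ℝ) (hR : ∀ h x a, IsProbabilityMeasure (R h x a))
    (π : Fin (n + 1) → X → PMF A) (x : X) {φ : (Fin (n + 1) → Sample X A) → ℝ≥0∞}
    (hφ : Measurable φ) :
    ∫⁻ τ, φ τ ∂(trajFrom (n + 1) P R π x) =
      ∫⁻ a, ∫⁻ s, ∫⁻ τ, φ (Fin.cons s τ)
        ∂(trajFrom n (fun h => P h.succ) (fun h => R h.succ) (fun h => π h.succ) s.2.2.2)
        ∂(transLaw (R 0) (P 0) (x, a)) ∂(π 0 x).toMeasure := by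
  have hp := fun y => isProbabilityMeasure_trajFrom n (fun h => P h.succ) (fun h => R h.succ)
    (fun h => hR h.succ) (fun h => π h.succ) y
  rw [trajFrom, Measure.lintegral_bind Measurable.of_discrete.aemeasurable hφ.aemeasurable]
  refine lintegral_congr fun a => ?_
  have hm := measurable_trajStep (trajFrom n (fun h => P h.succ) (fun h => R h.succ)
    (fun h => π h.succ)) x a
  rw [Measure.lintegral_bind hm.aemeasurable hφ.aemeasurable]
  have hc : Measurable fun p : (Sample X A) × (Fin n → Sample X A) =>
      φ (Fin.cons p.1 p.2 : Fin (n + 1) → Sample X A) := hφ.comp (measurable_fin_cons n)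
  rw [lintegral_transLaw]
  · exact lintegral_congr fun q =>
      lintegral_map hφ ((measurable_fin_cons n).comp measurable_prodMk_left)
  · have : Measurable fun p : (X × A × ℝ) × X => ∫⁻ τ, φ (Fin.cons (p.1.1, p.1.2.1, p.1.2.2, p.2) τ)
        ∂(trajFrom n (fun h => P h.succ) (fun h => R h.succ) (fun h => π h.succ) p.2) := by
      refine measurable_from_prod_countable_left fun y => ?_
      refine Measurable.lintegral_prod_right' (ν := trajFrom n (fun h => P h.succ)
        (fun h => R h.succ) (fun h => π h.succ) y)
        (f := fun p : (X × A × ℝ) × (Fin n → Sample X A) =>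
        φ (Fin.cons (p.1.1, p.1.2.1, p.1.2.2, y) p.2)) ?_
      exact hc.comp (by fun_prop : Measurable fun p : (X × A × ℝ) × (Fin n → Sample X A) =>
        (((p.1.1, p.1.2.1, p.1.2.2, y) : Sample X A), p.2))
    exact this.comp (by fun_prop : Measurable fun s : Sample X A =>
      ((s.1, s.2.1, s.2.2.1), s.2.2.2))

/-- Given the state-action pair of layer `h`, the transition of layer `h` follows the model. -/
lemma lintegral_trajFrom_eval {n : ℕ} (P : Fin n → X → A → PMF X)
    (R : Fin n → X → A → Measure ℝ) (hR : ∀ h x a, IsProbabilityMeasure (R h x a))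
    (π : Fin n → X → PMF A) (x : X) (h : Fin n) {φ : Sample X A → ℝ≥0∞} (hφ : Measurable φ) :
    ∫⁻ τ, φ (τ h) ∂(trajFrom n P R π x) =
      ∫⁻ τ, ∫⁻ s, φ s ∂(transLaw (R h) (P h) ((τ h).1, (τ h).2.1)) ∂(trajFrom n P R π x) := by
  induction n generalizing x with
  | zero => exact h.elim0
  | succ n ih =>
    have hG : ∀ i : Fin (n + 1), Measurable fun s : Sample X A =>
        ∫⁻ s', φ s' ∂(transLaw (R i) (P i) (s.1, s.2.1)) := fun i =>
      (Measurable.of_discrete (f := fun z : X × A => ∫⁻ s', φ s' ∂(transLaw (R i) (P i) z))).comp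
        (by fun_prop : Measurable fun s : Sample X A => (s.1, s.2.1))
    refine (lintegral_trajFrom_succ P R hR π x (hφ.comp (measurable_pi_apply h))).trans
      (Eq.trans ?_
      (lintegral_trajFrom_succ P R hR π x ((hG h).comp (measurable_pi_apply h))).symm)
    refine lintegral_congr fun a => ?_
    have hp := fun y => isProbabilityMeasure_trajFrom n (fun h => P h.succ) (fun h => R h.succ)
      (fun h => hR h.succ) (fun h => π h.succ) y
    have hprob := isProbabilityMeasure_transLaw (hR 0) (P 0) (x, a)
    revert h
    refine Fin.cases ?_ fun j => ?_
    · simp only [Function.comp_apply, Fin.cons_zero, lintegral_const, measure_univ, mul_one]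
      rw [lintegral_transLaw _ _ (hG 0)]
      have := hR 0 x a
      simp
    · simp only [Function.comp_apply, Fin.cons_succ]
      refine lintegral_congr fun s => ?_
      exact ih _ _ (fun h => hR h.succ) _ _ j

/-- Along an episode, states are passed on from layer to layer and actions are in the support of
the policy. -/
def IsChain {n : ℕ} (π : Fin n → X → PMF A) (x : X) (τ : Fin n → Sample X A) : Prop :=
  (∀ h : Fin n, π h (τ h).1 (τ h).2.1 ≠ 0) ∧ (∀ h : Fin n, h.val = 0 → (τ h).1 = x) ∧
    ∀ h h' : Fin n, h'.val = h.val + 1 → (τ h').1 = (τ h).2.2.2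

lemma measurableSet_isChain {n : ℕ} (π : Fin n → X → PMF A) (x : X) :
    MeasurableSet {τ : Fin n → Sample X A | IsChain π x τ} := by
  have h1 : ∀ h : Fin n, Measurable fun τ : Fin n → Sample X A => ((τ h).1, (τ h).2.1) :=
    fun h => by fun_prop
  have h2 : ∀ h h' : Fin n, Measurable fun τ : Fin n → Sample X A => ((τ h').1, (τ h).2.2.2) :=
    fun h h' => by fun_prop
  change MeasurableSet ({τ : Fin n → Sample X A | ∀ h : Fin n, π h (τ h).1 (τ h).2.1 ≠ 0} ∩
    ({τ | ∀ h : Fin n, h.val = 0 → (τ h).1 = x} ∩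
      {τ | ∀ h h' : Fin n, h'.val = h.val + 1 → (τ h').1 = (τ h).2.2.2}))
  refine MeasurableSet.inter ?_ (MeasurableSet.inter ?_ ?_)
  · have : {τ : Fin n → Sample X A | ∀ h : Fin n, π h (τ h).1 (τ h).2.1 ≠ 0}
      = ⋂ h : Fin n, (fun τ : Fin n → Sample X A => ((τ h).1, (τ h).2.1)) ⁻¹'
        {z | π h z.1 z.2 ≠ 0} := by ext; simp
    exact this ▸ MeasurableSet.iInter fun h => h1 h (MeasurableSet.of_discrete)
  · have : {τ : Fin n → Sample X A | ∀ h : Fin n, h.val = 0 → (τ h).1 = x}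
      = ⋂ h : Fin n, (fun τ : Fin n → Sample X A => ((τ h).1, (τ h).2.1)) ⁻¹'
        {z | h.val = 0 → z.1 = x} := by ext; simp
    exact this ▸ MeasurableSet.iInter fun h => h1 h (MeasurableSet.of_discrete)
  · have : {τ : Fin n → Sample X A | ∀ h h' : Fin n, h'.val = h.val + 1 → (τ h').1 = (τ h).2.2.2}
      = ⋂ h : Fin n, ⋂ h' : Fin n, (fun τ : Fin n → Sample X A => ((τ h').1, (τ h).2.2.2)) ⁻¹'
        {z | h'.val = h.val + 1 → z.1 = z.2} := by ext; simp
    exact this ▸ MeasurableSet.iInter fun h => MeasurableSet.iInter fun h' =>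
      h2 h h' (MeasurableSet.of_discrete)

lemma isChain_cons {n : ℕ} {π : Fin (n + 1) → X → PMF A} {x : X} {s : Sample X A}
    {τ : Fin n → Sample X A} (h0 : s.1 = x) (ha : π 0 x s.2.1 ≠ 0)
    (hτ : IsChain (fun h => π h.succ) s.2.2.2 τ) :
    IsChain π x (Fin.cons s τ : Fin (n + 1) → Sample X A) := by
  refine ⟨fun h => ?_, fun h hh => ?_, fun h h' => ?_⟩
  · refine Fin.cases ?_ (fun j => ?_) h
    · simpa [h0] using ha
    · simpa using hτ.1 j
  · obtain rfl : h = 0 := Fin.ext hh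
    simpa using h0
  · refine Fin.cases ?_ (fun j => ?_) h' <;> refine Fin.cases ?_ (fun i => ?_) h
    · simp
    · simp
    · intro hj
      simpa using hτ.2.1 j (by simpa using hj)
    · intro hj
      simpa using hτ.2.2 i j (by simpa using hj)

lemma ae_stateAction_transLaw {R : X → A → Measure ℝ} (P : X → A → PMF X) (z : X × A) :
    ∀ᵐ s ∂(transLaw R P z), ((s.1, s.2.1) : X × A) = z := by
  refine (ae_map_iff (measurable_mkSample z).aemeasurable ?_).2
    (Filter.Eventually.of_forall fun q => rfl)
  exact (by fun_prop : Measurable fun s : Sample X A => ((s.1, s.2.1) : X × A))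
    (MeasurableSet.of_discrete (s := {z}))

lemma ae_isChain_trajFrom {n : ℕ} (P : Fin n → X → A → PMF X)
    (R : Fin n → X → A → Measure ℝ) (hR : ∀ h x a, IsProbabilityMeasure (R h x a))
    (π : Fin n → X → PMF A) (x : X) : ∀ᵐ τ ∂(trajFrom n P R π x), IsChain π x τ := by
  induction n generalizing x with
  | zero => exact Filter.Eventually.of_forall fun τ =>
      ⟨fun h => h.elim0, fun h => h.elim0, fun h => h.elim0⟩
  | succ n ih =>
    have hS := (measurableSet_isChain π x).compl
    rw [ae_iff]
    change trajFrom (n + 1) P R π x {τ | IsChain π x τ}ᶜ = 0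
    rw [← lintegral_indicator_one hS, lintegral_trajFrom_succ P R hR π x
      (measurable_one.indicator hS)]
    refine (lintegral_congr_ae (g := fun _ => 0) ?_).trans (by simp)
    have hsupp : ∀ᵐ a ∂(π 0 x).toMeasure, π 0 x a ≠ 0 := by
      rw [ae_iff, PMF.toMeasure_apply_eq_zero_iff _ MeasurableSet.of_discrete,
        Set.disjoint_left]
      intro a ha
      simpa using ha
    filter_upwards [hsupp] with a ha
    refine (lintegral_congr_ae (g := fun _ => 0) ?_).trans (by simp)
    filter_upwards [ae_stateAction_transLaw (R := R 0) (P 0) (x, a)] with s hs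
    refine (lintegral_congr_ae (g := fun _ => 0) ?_).trans (by simp)
    filter_upwards [ih (fun h => P h.succ) (fun h => R h.succ) (fun h => hR h.succ)
      (fun h => π h.succ) s.2.2.2] with τ hτ
    simp only [Prod.mk.injEq] at hs
    exact Set.indicator_of_notMem (by simpa using isChain_cons hs.1 (hs.2 ▸ ha) hτ) _

variable {H : ℕ} (M : MDP H X A) (π : Policy H X A)

lemma MDP.sampleLaw_eq (h : Fin H) (q : PMF (X × A)) :
    M.sampleLaw h q = q.toMeasure.bind (transLaw (M.R h) (M.P h)) := rfl

instance MDP.isProbabilityMeasure_law : IsProbabilityMeasure (M.law π) :=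
  isProbabilityMeasure_bind Measurable.of_discrete
    fun x => isProbabilityMeasure_trajFrom H M.P M.R M.R_prob π x

instance MDP.isProbabilityMeasure_sampleLaw (h : Fin H) (q : PMF (X × A)) :
    IsProbabilityMeasure (M.sampleLaw h q) :=
  isProbabilityMeasure_bind Measurable.of_discrete
    fun z => isProbabilityMeasure_transLaw (M.R_prob h) (M.P h) z

lemma MDP.lintegral_law {φ : (Fin H → Sample X A) → ℝ≥0∞} (hφ : Measurable φ) :
    ∫⁻ τ, φ τ ∂(M.law π) = ∫⁻ x, ∫⁻ τ, φ τ ∂(trajFrom H M.P M.R π x) ∂M.init.toMeasure :=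
  Measure.lintegral_bind Measurable.of_discrete.aemeasurable hφ.aemeasurable

lemma MDP.lintegral_sampleLaw (h : Fin H) (q : PMF (X × A)) {φ : Sample X A → ℝ≥0∞}
    (hφ : Measurable φ) :
    ∫⁻ s, φ s ∂(M.sampleLaw h q) =
      ∫⁻ z, ∫⁻ s, φ s ∂(transLaw (M.R h) (M.P h) z) ∂q.toMeasure :=
  Measure.lintegral_bind Measurable.of_discrete.aemeasurable hφ.aemeasurable

lemma measurable_stateAction (h : Fin H) :
    Measurable fun τ : Fin H → Sample X A => ((τ h).1, (τ h).2.1) := by fun_prop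

/-- The occupancy measure as a probability mass function. -/
noncomputable def MDP.occPMF (h : Fin H) : PMF (X × A) :=
  haveI := Measure.isProbabilityMeasure_map (μ := M.law π) (measurable_stateAction h).aemeasurable
  ((M.law π).map fun τ => ((τ h).1, (τ h).2.1)).toPMF

lemma MDP.toMeasure_occPMF (h : Fin H) :
    (M.occPMF π h).toMeasure = (M.law π).map fun τ => ((τ h).1, (τ h).2.1) :=
  haveI := Measure.isProbabilityMeasure_map (μ := M.law π) (measurable_stateAction h).aemeasurable
  Measure.toPMF_toMeasure _

lemma MDP.occPMF_apply (h : Fin H) (z : X × A) : M.occPMF π h z = M.occ π h z :=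
  Measure.map_apply (measurable_stateAction h) (MeasurableSet.singleton z)

lemma MDP.tsum_occ (h : Fin H) : ∑' z, M.occ π h z = 1 := by
  simp_rw [← M.occPMF_apply]
  exact PMF.tsum_coe _

/-- The transition of layer `h` of an episode is distributed as a transition out of a state-action
pair drawn from the occupancy measure. -/
lemma MDP.map_law_eval (h : Fin H) :
    (M.law π).map (fun τ => τ h) = M.sampleLaw h (M.occPMF π h) := by
  refine Measure.ext_of_lintegral _ fun φ hφ => ?_
  rw [lintegral_map hφ (measurable_pi_apply h), M.lintegral_sampleLaw h _ hφ,
    M.toMeasure_occPMF, lintegral_map Measurable.of_discrete (measurable_stateAction h)]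
  refine (M.lintegral_law π (hφ.comp (measurable_pi_apply h))).trans (Eq.trans ?_
    (M.lintegral_law π ((Measurable.of_discrete (f := fun z : X × A =>
      ∫⁻ s, φ s ∂(transLaw (M.R h) (M.P h) z))).comp (measurable_stateAction h))).symm)
  exact lintegral_congr fun x => lintegral_trajFrom_eval M.P M.R M.R_prob π x h hφ

lemma MDP.ae_isChain : ∀ᵐ τ ∂(M.law π), ∃ x, IsChain π x τ := by
  have hS : MeasurableSet {τ : Fin H → Sample X A | ∃ x, IsChain π x τ} := by
    rw [Set.ofPred_exists]
    exact MeasurableSet.iUnion fun x => measurableSet_isChain π x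
  rw [ae_iff]
  change M.law π {τ | ∃ x, IsChain π x τ}ᶜ = 0
  rw [MDP.law, Measure.bind_apply hS.compl Measurable.of_discrete.aemeasurable]
  refine (lintegral_congr fun x => ?_).trans lintegral_zero
  have := ae_isChain_trajFrom M.P M.R M.R_prob π x
  exact measure_mono_null (fun τ hτ hx => hτ ⟨x, hx⟩) this

/-- An episode started in `x` almost surely has first state `x`. Since the right-hand side is free
of `π`, initial values cancel when two policies are compared. -/
lemma MDP.map_law_init (hH : 0 < H) :
    (M.law π).map (fun τ => (τ ⟨0, hH⟩).1) = M.init.toMeasure := by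
  have hm : Measurable fun τ : Fin H → Sample X A => (τ ⟨0, hH⟩).1 := by fun_prop
  refine Measure.ext_of_lintegral _ fun φ hφ => ?_
  rw [lintegral_map hφ hm]
  refine (M.lintegral_law π (hφ.comp hm)).trans ?_
  refine lintegral_congr fun x => ?_
  have := isProbabilityMeasure_trajFrom H M.P M.R M.R_prob π x
  rw [lintegral_congr_ae (g := fun _ => φ x)]
  · simp
  · filter_upwards [ae_isChain_trajFrom M.P M.R M.R_prob π x] with τ hτ
    simp [hτ.2.1 ⟨0, hH⟩ rfl]

end Trajectory

/-! ### Bellman errors and the performance difference -/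

section Bellman

variable {X : Type u} {A : Type v} [Countable X] [MeasurableSpace X] [DiscreteMeasurableSpace X]
  [Countable A] [MeasurableSpace A] [DiscreteMeasurableSpace A]

lemma bddAbove_range_of_mem_Icc {f : X → A → ℝ} (hf : ∀ x a, f x a ∈ Set.Icc (0 : ℝ) 1) (x : X) :
    BddAbove (Set.range (f x)) := ⟨1, by rintro _ ⟨a, rfl⟩; exact (hf x a).2⟩

lemma iSup_mem_Icc [Nonempty A] {f : X → A → ℝ} (hf : ∀ x a, f x a ∈ Set.Icc (0 : ℝ) 1) (x : X) :
    (⨆ a, f x a) ∈ Set.Icc (0 : ℝ) 1 :=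
  ⟨Real.iSup_nonneg fun a => (hf x a).1, ciSup_le fun a => (hf x a).2⟩

lemma nextQ_mem_Icc {H : ℕ} {f : QFun H X A} (hf : ∀ h x a, f h x a ∈ Set.Icc (0 : ℝ) 1)
    (h : Fin H) (x : X) (a : A) : nextQ f h x a ∈ Set.Icc (0 : ℝ) 1 := by
  unfold nextQ
  split_ifs with hh
  · exact hf _ x a
  · simp

variable {H : ℕ} (M : MDP H X A)

instance MDP.isProbabilityMeasure_transLaw (h : Fin H) (z : X × A) :
    IsProbabilityMeasure (transLaw (M.R h) (M.P h) z) :=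
  HybridRL.isProbabilityMeasure_transLaw (M.R_prob h) (M.P h) z

lemma measurableSet_reward_mem : MeasurableSet {s : Sample X A | s.2.2.1 ∈ Set.Icc (0 : ℝ) 1} :=
  (by fun_prop : Measurable fun s : Sample X A => s.2.2.1) measurableSet_Icc

lemma MDP.ae_reward_transLaw (h : Fin H) (z : X × A) :
    ∀ᵐ s ∂(transLaw (M.R h) (M.P h) z), s.2.2.1 ∈ Set.Icc (0 : ℝ) 1 := by
  refine (ae_map_iff (measurable_mkSample z).aemeasurable measurableSet_reward_mem).2 ?_
  have := M.R_prob h z.1 z.2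
  have h1 := M.R_mem h z.1 z.2
  exact Measure.quasiMeasurePreserving_fst.ae h1

lemma MDP.ae_sampleLaw {h : Fin H} {q : PMF (X × A)} {p : Sample X A → Prop}
    (hp : MeasurableSet {s | p s}) (hz : ∀ z, ∀ᵐ s ∂(transLaw (M.R h) (M.P h) z), p s) :
    ∀ᵐ s ∂(M.sampleLaw h q), p s := by
  rw [ae_iff]
  change M.sampleLaw h q {s | p s}ᶜ = 0
  rw [M.sampleLaw_eq, Measure.bind_apply hp.compl Measurable.of_discrete.aemeasurable]
  exact (lintegral_congr fun z => hz z).trans lintegral_zero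

lemma MDP.ae_reward_law (π : Policy H X A) :
    ∀ᵐ τ ∂(M.law π), ∀ h, (τ h).2.2.1 ∈ Set.Icc (0 : ℝ) 1 := by
  refine ae_all_iff.2 fun h => ?_
  refine ae_of_ae_map (f := fun τ : Fin H → Sample X A => τ h)
    (p := fun s => s.2.2.1 ∈ Set.Icc (0 : ℝ) 1) (measurable_pi_apply h).aemeasurable ?_
  rw [M.map_law_eval π h]
  exact M.ae_sampleLaw measurableSet_reward_mem (M.ae_reward_transLaw h)

lemma measurable_target (f : X → A → ℝ) :
    Measurable fun s : Sample X A => s.2.2.1 + ⨆ a', f s.2.2.2 a' :=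
  (by fun_prop : Measurable fun s : Sample X A => s.2.2.1).add
    ((Measurable.of_discrete (f := fun x => ⨆ a', f x a')).comp
      (by fun_prop : Measurable fun s : Sample X A => s.2.2.2))

lemma MDP.bellman_eq (h : Fin H) (f : X → A → ℝ) (z : X × A) :
    M.bellman h f z.1 z.2 =
      ∫ s, (s.2.2.1 + ⨆ a', f s.2.2.2 a') ∂(transLaw (M.R h) (M.P h) z) := by
  exact (integral_map (measurable_mkSample z).aemeasurable (measurable_target f).aestronglyMeasurable).symm

lemma integrable_of_mem_Icc {α : Type*} [MeasurableSpace α] {m : Measure α} [IsFiniteMeasure m]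
    {φ : α → ℝ} (hφ : Measurable φ) {a b : ℝ} (h : ∀ᵐ x ∂m, φ x ∈ Set.Icc a b) :
    Integrable φ m :=
  Integrable.of_bound hφ.aestronglyMeasurable (max |a| |b|) (h.mono fun _ hx => by
    rw [Real.norm_eq_abs]; exact abs_le_max_abs_abs hx.1 hx.2)

lemma MDP.ae_target_transLaw [Nonempty A] (h : Fin H) (z : X × A) {f : X → A → ℝ}
    (hf : ∀ x a, f x a ∈ Set.Icc (0 : ℝ) 1) :
    ∀ᵐ s ∂(transLaw (M.R h) (M.P h) z), (s.2.2.1 + ⨆ a', f s.2.2.2 a') ∈ Set.Icc (0 : ℝ) 2 := by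
  filter_upwards [M.ae_reward_transLaw h z] with s hs
  have := iSup_mem_Icc hf s.2.2.2
  exact ⟨add_nonneg hs.1 this.1, by linarith [hs.2, this.2]⟩

/-- The crude range, from reward plus next value. The sharper range `[0, 1]` used for regression
comes from completeness instead. -/
lemma MDP.bellman_mem_Icc [Nonempty A] (h : Fin H) {f : X → A → ℝ}
    (hf : ∀ x a, f x a ∈ Set.Icc (0 : ℝ) 1) (z : X × A) :
    M.bellman h f z.1 z.2 ∈ Set.Icc (0 : ℝ) 2 := by
  rw [M.bellman_eq]
  have h1 := M.ae_target_transLaw h z hf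
  refine ⟨integral_nonneg_of_ae (h1.mono fun s hs => hs.1), ?_⟩
  refine (integral_mono_ae (integrable_of_mem_Icc (measurable_target f) h1)
    (integrable_const (2 : ℝ)) (h1.mono fun s hs => hs.2)).trans ?_
  simp

lemma MDP.integral_target_sampleLaw [Nonempty A] (h : Fin H) (q : PMF (X × A)) {f : X → A → ℝ}
    (hf : ∀ x a, f x a ∈ Set.Icc (0 : ℝ) 1) :
    ∫ s, (s.2.2.1 + ⨆ a', f s.2.2.2 a') ∂(M.sampleLaw h q) =
      ∫ z, M.bellman h f z.1 z.2 ∂q.toMeasure := by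
  have hm := measurable_target (X := X) f
  rw [integral_eq_lintegral_of_nonneg_ae, integral_eq_lintegral_of_nonneg_ae,
    M.lintegral_sampleLaw h q (by fun_prop)]
  · congr 1
    refine lintegral_congr fun z => ?_
    have h1 := M.ae_target_transLaw h z hf
    rw [M.bellman_eq, ofReal_integral_eq_lintegral_ofReal (integrable_of_mem_Icc hm h1)
      (h1.mono fun s hs => hs.1)]
  · exact Filter.Eventually.of_forall fun z => (M.bellman_mem_Icc h hf z).1
  · exact Measurable.of_discrete.aestronglyMeasurable
  · exact M.ae_sampleLaw (hm measurableSet_Ici)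
      fun z => (M.ae_target_transLaw h z hf).mono fun s hs => hs.1
  · exact hm.aestronglyMeasurable

/-- Along a chain, the next value of layer `h` is the maximal value at the state of layer `h + 1`,
so bounding each `f_h` by its maximum makes the sum telescope; greedy actions lose nothing. -/
lemma sum_le_of_isChain [Nonempty A] {f : QFun H X A}
    (hf : ∀ h x a, f h x a ∈ Set.Icc (0 : ℝ) 1) {π : Policy H X A} {x : X}
    {τ : Fin H → Sample X A} (hτ : IsChain π x τ) (hH : 0 < H) :
    ∑ h, (f h (τ h).1 (τ h).2.1 - ⨆ a', nextQ f h (τ h).2.2.2 a') ≤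
        ⨆ a', f ⟨0, hH⟩ (τ ⟨0, hH⟩).1 a' ∧
      ((∀ h, f h (τ h).1 (τ h).2.1 = ⨆ a', f h (τ h).1 a') →
        ∑ h, (f h (τ h).1 (τ h).2.1 - ⨆ a', nextQ f h (τ h).2.2.2 a') =
          ⨆ a', f ⟨0, hH⟩ (τ ⟨0, hH⟩).1 a') := by
  -- The value `0` at `k = H` encodes `f_{H+1} = 0` and removes the last term of the telescope.
  let c : ℕ → ℝ := fun k => if hk : k < H then ⨆ a', f ⟨k, hk⟩ (τ ⟨k, hk⟩).1 a' else 0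
  have hc : ∀ h : Fin H, c h = ⨆ a', f h (τ h).1 a' := fun h => dif_pos h.isLt
  have hb : ∀ h : Fin H, ⨆ a', nextQ f h (τ h).2.2.2 a' = c (h + 1) := by
    intro h
    by_cases hh : h.val + 1 < H
    · simp only [nextQ, hh, c, dif_pos]
      rw [hτ.2.2 h ⟨h.val + 1, hh⟩ rfl]
    · simp only [nextQ, hh, c, dif_neg, not_false_iff, ciSup_const]
  have hsum : ∑ h : Fin H, (c h - c (h + 1)) = ⨆ a', f ⟨0, hH⟩ (τ ⟨0, hH⟩).1 a' := by
    rw [Fin.sum_univ_eq_sum_range (fun k => c k - c (k + 1)), Finset.sum_range_sub', hc ⟨0, hH⟩]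
    simp [c]
  refine ⟨?_, fun hg => ?_⟩
  · rw [← hsum]
    refine Finset.sum_le_sum fun h _ => ?_
    rw [hb, hc]
    exact sub_le_sub_right (le_ciSup (bddAbove_range_of_mem_Icc (hf h) _) _) _
  · rw [← hsum]
    exact Finset.sum_congr rfl fun h _ => by rw [hb, hc, hg]

lemma MDP.integral_occ (π : Policy H X A) (h : Fin H) (φ : X → A → ℝ) :
    ∫ z, φ z.1 z.2 ∂(M.occPMF π h).toMeasure = ∫ τ, φ (τ h).1 (τ h).2.1 ∂(M.law π) := by
  rw [M.toMeasure_occPMF, integral_map (measurable_stateAction h).aemeasurable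
    Measurable.of_discrete.aestronglyMeasurable]

/-- The expected reward plus the expected Bellman errors telescope along an episode. -/
lemma MDP.J_add_sum [Nonempty A] {f : QFun H X A}
    (hf : ∀ h x a, f h x a ∈ Set.Icc (0 : ℝ) 1) (π : Policy H X A) :
    M.J π + ∑ h, ∫ z, (f h z.1 z.2 - M.bellman h (nextQ f h) z.1 z.2) ∂(M.occPMF π h).toMeasure =
      ∫ τ, ∑ h, (f h (τ h).1 (τ h).2.1 - ⨆ a', nextQ f h (τ h).2.2.2 a') ∂(M.law π) := by
  have hN := fun h => nextQ_mem_Icc hf h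
  have hr : ∀ h : Fin H, Integrable (fun τ : Fin H → Sample X A => (τ h).2.2.1) (M.law π) :=
    fun h => integrable_of_mem_Icc (by fun_prop) ((M.ae_reward_law π).mono fun τ hτ => hτ h)
  have hV : ∀ h : Fin H, Integrable (fun τ : Fin H → Sample X A =>
      ⨆ a', nextQ f h (τ h).2.2.2 a') (M.law π) := fun h =>
    integrable_of_mem_Icc ((Measurable.of_discrete (f := fun x => ⨆ a', nextQ f h x a')).comp
      (by fun_prop : Measurable fun τ : Fin H → Sample X A => (τ h).2.2.2))
      (Filter.Eventually.of_forall fun τ => iSup_mem_Icc (hN h) _)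
  have hfi : ∀ h : Fin H, Integrable (fun τ : Fin H → Sample X A => f h (τ h).1 (τ h).2.1)
      (M.law π) := fun h =>
    integrable_of_mem_Icc ((Measurable.of_discrete (f := fun z : X × A => f h z.1 z.2)).comp
      (measurable_stateAction h)) (Filter.Eventually.of_forall fun τ => hf h _ _)
  have hs : ∫ τ, ∑ h, (f h (τ h).1 (τ h).2.1 - ⨆ a', nextQ f h (τ h).2.2.2 a') ∂(M.law π) =
      ∑ h, ∫ τ, (f h (τ h).1 (τ h).2.1 - ⨆ a', nextQ f h (τ h).2.2.2 a') ∂(M.law π) :=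
    integral_finsetSum _ fun h _ => (hfi h).sub (hV h)
  rw [MDP.J, integral_finsetSum _ fun h _ => hr h, hs, ← Finset.sum_add_distrib]
  refine Finset.sum_congr rfl fun h _ => ?_
  -- Tower property: a transition of layer `h` along the episode is a model transition out of an
  -- occupancy-distributed pair.
  have h1 : ∫ z, M.bellman h (nextQ f h) z.1 z.2 ∂(M.occPMF π h).toMeasure =
      ∫ τ, (τ h).2.2.1 ∂(M.law π) + ∫ τ, (⨆ a', nextQ f h (τ h).2.2.2 a') ∂(M.law π) := by
    rw [← M.integral_target_sampleLaw h _ (hN h), ← M.map_law_eval π h,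
      integral_map (measurable_pi_apply h).aemeasurable (measurable_target _).aestronglyMeasurable]
    exact integral_add (hr h) (hV h)
  rw [integral_sub (hfi h) (hV h), integral_sub, h1, M.integral_occ π h (f h)]
  · ring
  · exact integrable_of_mem_Icc Measurable.of_discrete
      (Filter.Eventually.of_forall fun z => hf h _ _)
  · exact integrable_of_mem_Icc Measurable.of_discrete
      (Filter.Eventually.of_forall fun z => M.bellman_mem_Icc h (hN h) z)

/-- Performance difference: the regret of a greedy policy is at most its Bellman errors. -/
theorem MDP.J_sub_le_sum_bellman_error [Nonempty A] {f : QFun H X A}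
    (hf : ∀ h x a, f h x a ∈ Set.Icc (0 : ℝ) 1) {g : Fin H → X → A}
    (hg : ∀ h x a, f h x a ≤ f h x (g h x)) (π : Policy H X A) :
    M.J π - M.J (detPolicy g) ≤
      ∑ h, (∫ z, |f h z.1 z.2 - M.bellman h (nextQ f h) z.1 z.2| ∂(M.occPMF π h).toMeasure +
        ∫ z, |f h z.1 z.2 - M.bellman h (nextQ f h) z.1 z.2|
          ∂(M.occPMF (detPolicy g) h).toMeasure) := by
  rcases Nat.eq_zero_or_pos H with rfl | hH
  · simp [MDP.J]
  set e : Fin H → X × A → ℝ := fun h z => f h z.1 z.2 - M.bellman h (nextQ f h) z.1 z.2 with he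
  have hcm : Measurable fun x => ⨆ a', f ⟨0, hH⟩ x a' := Measurable.of_discrete
  have hτm : Measurable fun τ : Fin H → Sample X A => (τ ⟨0, hH⟩).1 := by fun_prop
  have hinit : ∀ π : Policy H X A, ∫ τ, ⨆ a', f ⟨0, hH⟩ (τ ⟨0, hH⟩).1 a' ∂(M.law π) =
      ∫ x, ⨆ a', f ⟨0, hH⟩ x a' ∂M.init.toMeasure := by
    intro π
    rw [← M.map_law_init π hH, integral_map hτm.aemeasurable hcm.aestronglyMeasurable]
  have hint : ∀ π : Policy H X A, Integrable (fun τ : Fin H → Sample X A =>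
      ∑ h, (f h (τ h).1 (τ h).2.1 - ⨆ a', nextQ f h (τ h).2.2.2 a')) (M.law π) := by
    refine fun π => integrable_finsetSum _ fun h _ => Integrable.sub ?_ ?_
    · exact integrable_of_mem_Icc ((Measurable.of_discrete (f := fun z : X × A => f h z.1 z.2)).comp
        (measurable_stateAction h)) (Filter.Eventually.of_forall fun τ => hf h _ _)
    · exact integrable_of_mem_Icc ((Measurable.of_discrete (f := fun x => ⨆ a', nextQ f h x a')).comp
        (by fun_prop : Measurable fun τ : Fin H → Sample X A => (τ h).2.2.2))
        (Filter.Eventually.of_forall fun τ => iSup_mem_Icc (nextQ_mem_Icc hf h) _)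
  -- Both policies are compared with the same initial value: inequality for an arbitrary policy
  -- here, equality for the greedy one in `h2`.
  have h1 : M.J π + ∑ h, ∫ z, e h z ∂(M.occPMF π h).toMeasure ≤
      ∫ x, ⨆ a', f ⟨0, hH⟩ x a' ∂M.init.toMeasure := by
    rw [M.J_add_sum hf π, ← hinit π]
    refine integral_mono_ae (hint π) (integrable_of_mem_Icc (hcm.comp hτm)
      (Filter.Eventually.of_forall fun τ => iSup_mem_Icc (hf _) _)) ?_
    filter_upwards [M.ae_isChain π] with τ ⟨x, hτ⟩
    exact (sum_le_of_isChain hf hτ hH).1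
  have h2 : M.J (detPolicy g) + ∑ h, ∫ z, e h z ∂(M.occPMF (detPolicy g) h).toMeasure =
      ∫ x, ⨆ a', f ⟨0, hH⟩ x a' ∂M.init.toMeasure := by
    rw [M.J_add_sum hf, ← hinit (detPolicy g)]
    refine integral_congr_ae ?_
    filter_upwards [M.ae_isChain (detPolicy g)] with τ ⟨x, hτ⟩
    refine (sum_le_of_isChain hf hτ hH).2 fun h => ?_
    have ha : (τ h).2.1 = g h (τ h).1 := by
      by_contra hne
      exact hτ.1 h (by simp [detPolicy, PMF.pure_apply, hne])
    rw [ha]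
    exact le_antisymm (le_ciSup (bddAbove_range_of_mem_Icc (hf h) _) _) (ciSup_le (hg h _))
  have h3 : ∀ (π : Policy H X A) h, |∫ z, e h z ∂(M.occPMF π h).toMeasure| ≤
      ∫ z, |e h z| ∂(M.occPMF π h).toMeasure := fun π h => abs_integral_le_integral_abs
  rw [Finset.sum_add_distrib]
  have h4 : -∑ h, ∫ z, e h z ∂(M.occPMF π h).toMeasure ≤
      ∑ h, ∫ z, |e h z| ∂(M.occPMF π h).toMeasure := by
    rw [← Finset.sum_neg_distrib]
    exact Finset.sum_le_sum fun h _ => (neg_le_abs _).trans (h3 π h)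
  have h5 : ∑ h, ∫ z, e h z ∂(M.occPMF (detPolicy g) h).toMeasure ≤
      ∑ h, ∫ z, |e h z| ∂(M.occPMF (detPolicy g) h).toMeasure :=
    Finset.sum_le_sum fun h _ => (le_abs_self _).trans (h3 _ h)
  change M.J π - M.J (detPolicy g) ≤ ∑ h, ∫ z, |e h z| ∂(M.occPMF π h).toMeasure +
    ∑ h, ∫ z, |e h z| ∂(M.occPMF (detPolicy g) h).toMeasure
  linarith

lemma MDP.Normalized.J_mem_Icc {M : MDP H X A} (hM : M.Normalized) (π : Policy H X A) :
    M.J π ∈ Set.Icc (0 : ℝ) 1 := by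
  have h1 := hM π
  refine ⟨integral_nonneg_of_ae (h1.mono fun s hs => hs.1), ?_⟩
  refine (integral_mono_ae (integrable_of_mem_Icc (Finset.measurable_sum _ fun h _ => ?_) h1)
    (integrable_const (1 : ℝ)) (h1.mono fun s hs => hs.2)).trans ?_
  · fun_prop
  · simp

end Bellman

/-! ### Exponential moments of the excess squared loss -/

section ExcessLoss

variable {X : Type u} {A : Type v} [Countable X] [MeasurableSpace X] [DiscreteMeasurableSpace X]
  [Countable A] [MeasurableSpace A] [DiscreteMeasurableSpace A] {H : ℕ} (M : MDP H X A)

/-- The excess squared loss of `g` over the Bellman backup of `f` on a transition. -/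
noncomputable def MDP.excessLoss (h : Fin H) (g f : X → A → ℝ) (s : Sample X A) : ℝ :=
  (g s.1 s.2.1 - s.2.2.1 - ⨆ a', f s.2.2.2 a') ^ 2 -
    (M.bellman h f s.1 s.2.1 - s.2.2.1 - ⨆ a', f s.2.2.2 a') ^ 2

/-- The squared Bellman error of `g` with respect to `f`. -/
noncomputable def MDP.sqError (h : Fin H) (g f : X → A → ℝ) (z : X × A) : ℝ :=
  (g z.1 z.2 - M.bellman h f z.1 z.2) ^ 2

lemma MDP.measurable_excessLoss (h : Fin H) (g f : X → A → ℝ) :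
    Measurable (M.excessLoss h g f) := by
  have h1 : ∀ φ : X → A → ℝ, Measurable fun s : Sample X A => φ s.1 s.2.1 := fun φ =>
    (Measurable.of_discrete (f := fun z : X × A => φ z.1 z.2)).comp
      (by fun_prop : Measurable fun s : Sample X A => (s.1, s.2.1))
  have h2 : Measurable fun s : Sample X A => ⨆ a', f s.2.2.2 a' :=
    (Measurable.of_discrete (f := fun x => ⨆ a', f x a')).comp
      (by fun_prop : Measurable fun s : Sample X A => s.2.2.2)
  have h3 : Measurable fun s : Sample X A => s.2.2.1 := by fun_prop
  exact ((((h1 g).sub h3).sub h2).pow_const 2).sub ((((h1 _).sub h3).sub h2).pow_const 2)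

/-- Second-order expansion of the exponential: the quadratic term is at most `16 D² / 32² = D² /
64`, half of what the linear term yields when `x` has mean `D²`. -/
lemma exp_neg_div_le {x D : ℝ} (hx : |x| ≤ 4 * |D|) (hD : |D| ≤ 1) :
    Real.exp (-x / 32) ≤ 1 - x / 32 + D ^ 2 / 64 := by
  have h1 : |(-x / 32)| ≤ 1 := by
    rw [abs_div, abs_neg, abs_of_pos (by norm_num : (0 : ℝ) < 32)]
    linarith
  have h2 := (abs_le.1 (Real.abs_exp_sub_one_sub_id_le h1)).2
  have h3 : x ^ 2 ≤ 16 * D ^ 2 := by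
    rw [← sq_abs x, ← sq_abs D]
    nlinarith [abs_nonneg x, abs_nonneg D]
  nlinarith

variable [Nonempty A] {h : Fin H} {g f : X → A → ℝ}

lemma MDP.sqError_mem_Icc (hg : ∀ x a, g x a ∈ Set.Icc (0 : ℝ) 1)
    (hb : ∀ x a, M.bellman h f x a ∈ Set.Icc (0 : ℝ) 1) (z : X × A) :
    M.sqError h g f z ∈ Set.Icc (0 : ℝ) 1 := by
  have h1 := hg z.1 z.2
  have h2 := hb z.1 z.2
  exact ⟨sq_nonneg _, (sq_le_one_iff_abs_le_one _).2
    (abs_le.2 ⟨by linarith [h1.1, h2.2], by linarith [h1.2, h2.1]⟩)⟩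

/-- With `Y` the regression target, of mean `b`, and `D = g - b`, the excess loss is `D (g + b -
2Y)`: its mean is `D²` and its size at most `4|D|`. The expansion above then has mean `1 - D²/32 +
D²/64`. -/
lemma MDP.lintegral_exp_excessLoss_transLaw (hg : ∀ x a, g x a ∈ Set.Icc (0 : ℝ) 1)
    (hf : ∀ x a, f x a ∈ Set.Icc (0 : ℝ) 1)
    (hb : ∀ x a, M.bellman h f x a ∈ Set.Icc (0 : ℝ) 1) (z : X × A) :
    ∫⁻ s, ENNReal.ofReal (Real.exp (-M.excessLoss h g f s / 32)) ∂(transLaw (M.R h) (M.P h) z) ≤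
      ENNReal.ofReal (1 - M.sqError h g f z / 64) := by
  set b := M.bellman h f z.1 z.2 with hbdef
  set D := g z.1 z.2 - b with hD
  let Y : Sample X A → ℝ := fun s => s.2.2.1 + ⨆ a', f s.2.2.2 a'
  have hY : Integrable Y (transLaw (M.R h) (M.P h) z) :=
    integrable_of_mem_Icc (measurable_target f) (M.ae_target_transLaw h z hf)
  have hbz := hb z.1 z.2
  have hgz := hg z.1 z.2
  have hD1 : |D| ≤ 1 := abs_le.2 ⟨by linarith [hgz.1, hbz.2], by linarith [hgz.2, hbz.1]⟩
  have key : ∀ᵐ s ∂(transLaw (M.R h) (M.P h) z), Real.exp (-M.excessLoss h g f s / 32) ≤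
      (1 - D ^ 2 / 64 - D * b / 16) + D / 16 * Y s := by
    filter_upwards [ae_stateAction_transLaw (R := M.R h) (M.P h) z, M.ae_target_transLaw h z hf]
      with s hs hYs
    have hx : M.excessLoss h g f s = D * (g z.1 z.2 + b - 2 * Y s) := by
      rw [MDP.excessLoss, show s.1 = z.1 from congrArg Prod.fst hs,
        show s.2.1 = z.2 from congrArg Prod.snd hs]
      simp only [Y, hD, hbdef]
      ring
    have h4 : |g z.1 z.2 + b - 2 * Y s| ≤ 4 :=
      abs_le.2 ⟨by linarith [hgz.1, hbz.1, hYs.2], by linarith [hgz.2, hbz.2, hYs.1]⟩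
    refine (exp_neg_div_le (D := D) ?_ hD1).trans (le_of_eq ?_)
    · rw [hx, abs_mul, mul_comm]
      exact mul_le_mul_of_nonneg_right h4 (abs_nonneg D)
    · rw [hx, show g z.1 z.2 = D + b by rw [hD]; ring]
      ring
  calc _ ≤ ∫⁻ s, ENNReal.ofReal ((1 - D ^ 2 / 64 - D * b / 16) + D / 16 * Y s)
        ∂(transLaw (M.R h) (M.P h) z) :=
        lintegral_mono_ae (key.mono fun s hs => ENNReal.ofReal_le_ofReal hs)
    _ = ENNReal.ofReal (∫ s, ((1 - D ^ 2 / 64 - D * b / 16) + D / 16 * Y s)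
        ∂(transLaw (M.R h) (M.P h) z)) :=
        (ofReal_integral_eq_lintegral_ofReal ((integrable_const _).add (hY.const_mul _))
          (key.mono fun s hs => (Real.exp_pos _).le.trans hs)).symm
    _ = _ := by
        rw [integral_add (integrable_const _) (hY.const_mul _), integral_const_mul,
          show ∫ s, Y s ∂(transLaw (M.R h) (M.P h) z) = b from (M.bellman_eq h f z).symm]
        congr 1
        simp only [integral_const, probReal_univ, one_smul, MDP.sqError]
        ring

/-- Average the pointwise bound over the state-action pair and use `1 + u ≤ exp u`. -/
lemma MDP.lintegral_exp_excessLoss_sampleLaw (hg : ∀ x a, g x a ∈ Set.Icc (0 : ℝ) 1)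
    (hf : ∀ x a, f x a ∈ Set.Icc (0 : ℝ) 1)
    (hb : ∀ x a, M.bellman h f x a ∈ Set.Icc (0 : ℝ) 1) (q : PMF (X × A)) :
    ∫⁻ s, ENNReal.ofReal (Real.exp (-M.excessLoss h g f s / 32)) ∂(M.sampleLaw h q) ≤
      ENNReal.ofReal (Real.exp (-(∫ z, M.sqError h g f z ∂q.toMeasure) / 64)) := by
  have hmeas := M.measurable_excessLoss h g f
  have hm : Measurable fun s => ENNReal.ofReal (Real.exp (-M.excessLoss h g f s / 32)) := by
    fun_prop
  have hint : Integrable (M.sqError h g f) q.toMeasure :=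
    integrable_of_mem_Icc Measurable.of_discrete
      (Filter.Eventually.of_forall (M.sqError_mem_Icc hg hb))
  rw [M.lintegral_sampleLaw h q hm]
  calc _ ≤ ∫⁻ z, ENNReal.ofReal (1 - M.sqError h g f z / 64) ∂q.toMeasure :=
        lintegral_mono fun z => M.lintegral_exp_excessLoss_transLaw hg hf hb z
    _ = ENNReal.ofReal (∫ z, (1 - M.sqError h g f z / 64) ∂q.toMeasure) := by
        refine (ofReal_integral_eq_lintegral_ofReal
          ((integrable_const _).sub (hint.div_const _)) ?_).symm
        refine Filter.Eventually.of_forall fun z => ?_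
        have := (M.sqError_mem_Icc hg hb z).2
        simp only [Pi.zero_apply, Pi.sub_apply]
        linarith
    _ ≤ _ := by
        refine ENNReal.ofReal_le_ofReal ?_
        rw [integral_sub (integrable_const _) (hint.div_const _), integral_div]
        simp only [integral_const, probReal_univ, one_smul]
        have := Real.add_one_le_exp (-(∫ z, M.sqError h g f z ∂q.toMeasure) / 64)
        linarith

end ExcessLoss

/-! ### Conditional laws of adaptive data -/

section Adaptive

variable {X : Type u} {A : Type v} [Countable X] [MeasurableSpace X] [DiscreteMeasurableSpace X]
  [Countable A] [MeasurableSpace A] [DiscreteMeasurableSpace A] {H : ℕ} (M : MDP H X A)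
  {Ω : Type w} {m mΩ : MeasurableSpace Ω} {Pr : Measure Ω} [IsProbabilityMeasure Pr]

lemma MDP.lintegral_sampleLaw_eq_tsum (h : Fin H) (q : PMF (X × A)) {φ : Sample X A → ℝ≥0∞}
    (hφ : Measurable φ) :
    ∫⁻ s, φ s ∂(M.sampleLaw h q) =
      ∑' z, (∫⁻ s, φ s ∂(transLaw (M.R h) (M.P h) z)) * q z := by
  rw [M.lintegral_sampleLaw h q hφ, lintegral_countable']
  simp_rw [PMF.toMeasure_apply_singleton _ _ (MeasurableSet.singleton _)]

/-- A transition remembers the pair it started from, so the data distribution can be read off from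
the law of the transition. This is what makes it measurable with respect to the past. -/
lemma MDP.sampleLaw_stateAction (h : Fin H) (q : PMF (X × A)) (z : X × A) :
    M.sampleLaw h q {s | (s.1, s.2.1) = z} = q z := by
  have hS : MeasurableSet {s : Sample X A | (s.1, s.2.1) = z} :=
    (by fun_prop : Measurable fun s : Sample X A => ((s.1, s.2.1) : X × A))
      (MeasurableSet.of_discrete (s := {z}))
  rw [← lintegral_indicator_one hS, M.lintegral_sampleLaw_eq_tsum h q
    (measurable_one.indicator hS)]
  simp_rw [lintegral_indicator_one hS]
  have hne : ∀ z' : X × A, z' ≠ z →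
      transLaw (M.R h) (M.P h) z' {s : Sample X A | (s.1, s.2.1) = z} = 0 := by
    intro z' hz
    refine measure_mono_null ?_ (ae_stateAction_transLaw (R := M.R h) (M.P h) z')
    rintro s (hs : (s.1, s.2.1) = z) (hs' : (s.1, s.2.1) = z')
    exact hz (hs' ▸ hs)
  rw [tsum_eq_single z fun z' hz => by rw [hne z' hz, zero_mul]]
  have h1 : transLaw (M.R h) (M.P h) z {s : Sample X A | (s.1, s.2.1) = z} = 1 :=
    (prob_compl_eq_zero_iff hS).1 (ae_stateAction_transLaw (R := M.R h) (M.P h) z)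
  rw [h1, one_mul]

variable {h : Fin H} {ζ : Ω → Sample X A} {ρ : Ω → PMF (X × A)}

/-- The data distributions of conditional laws are determined by the past. -/
lemma MDP.exists_measurable_version
    (hcond : ∀ S : Set (Sample X A), MeasurableSet S →
      Pr[Set.indicator {ω | ζ ω ∈ S} (fun _ => (1 : ℝ)) | m]
        =ᵐ[Pr] fun ω => (M.sampleLaw h (ρ ω) S).toReal) :
    ∃ q : X × A → Ω → ℝ≥0∞, (∀ z, Measurable[m] (q z)) ∧ ∀ᵐ ω ∂Pr, ∀ z, ρ ω z = q z ω := by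
  have hS : ∀ z : X × A, MeasurableSet {s : Sample X A | (s.1, s.2.1) = z} := fun z =>
    (by fun_prop : Measurable fun s : Sample X A => ((s.1, s.2.1) : X × A))
      (MeasurableSet.of_discrete (s := {z}))
  refine ⟨fun z ω => ENNReal.ofReal ((Pr[Set.indicator
    {ω | ζ ω ∈ {s : Sample X A | (s.1, s.2.1) = z}} (fun _ => (1 : ℝ)) | m]) ω), fun z =>
    stronglyMeasurable_condExp.measurable.ennreal_ofReal, ?_⟩
  refine ae_all_iff.2 fun z => ?_
  filter_upwards [hcond _ (hS z)] with ω hω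
  rw [hω, M.sampleLaw_stateAction, ENNReal.ofReal_toReal (PMF.apply_ne_top _ _)]

lemma measurable_tsum_const_mul {α ι : Type*} {_ : MeasurableSpace α} [Countable ι]
    (c : ι → ℝ≥0∞) {q : ι → α → ℝ≥0∞} (hq : ∀ i, Measurable (q i)) :
    Measurable fun ω => ∑' i, c i * q i ω :=
  Measurable.tsum fun i => (hq i).const_mul _

/-- Integration of a function of the past and the current transition. -/
lemma MDP.lintegral_mul_comp (hm : m ≤ mΩ) (hζ : Measurable ζ)
    (hcond : ∀ S : Set (Sample X A), MeasurableSet S →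
      Pr[Set.indicator {ω | ζ ω ∈ S} (fun _ => (1 : ℝ)) | m]
        =ᵐ[Pr] fun ω => (M.sampleLaw h (ρ ω) S).toReal)
    {Z : Ω → ℝ≥0∞} (hZ : Measurable[m] Z) {φ : Sample X A → ℝ≥0∞} (hφ : Measurable φ) :
    ∫⁻ ω, Z ω * φ (ζ ω) ∂Pr = ∫⁻ ω, Z ω * ∫⁻ s, φ s ∂(M.sampleLaw h (ρ ω)) ∂Pr := by
  obtain ⟨q, hqm, hq⟩ := M.exists_measurable_version hcond
  have hqm' : ∀ z, Measurable (q z) := fun z => (hqm z).mono hm le_rfl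
  set κ := transLaw (M.R h) (M.P h) with hκ
  have hlaw : ∀ ψ : Sample X A → ℝ≥0∞, Measurable ψ →
      (fun ω => ∫⁻ s, ψ s ∂(M.sampleLaw h (ρ ω))) =ᵐ[Pr]
        fun ω => ∑' z, (∫⁻ s, ψ s ∂(κ z)) * q z ω := by
    intro ψ hψ
    filter_upwards [hq] with ω hω
    simp_rw [M.lintegral_sampleLaw_eq_tsum h _ hψ, hω, hκ]
  have hKm : Measurable fun ω => ∑' z, (∫⁻ s, φ s ∂(κ z)) * q z ω :=
    Measurable.tsum fun z => (hqm' z).const_mul _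
  have hset : ∀ B, MeasurableSet[m] B →
      ∫⁻ ω in B, φ (ζ ω) ∂Pr = ∫⁻ ω in B, ∑' z, (∫⁻ s, φ s ∂(κ z)) * q z ω ∂Pr := by
    intro B hB
    -- On an event of the past, the transition is a mixture of the model transitions out of the
    -- pairs `z`, weighted by the mass that the data distribution puts on `z`.
    have hmeas : (Pr.restrict B).map ζ = Measure.sum fun z => (∫⁻ ω in B, q z ω ∂Pr) • κ z := by
      ext S hS
      have hind : Integrable (Set.indicator {ω | ζ ω ∈ S} (fun _ => (1 : ℝ))) Pr :=
        (integrable_const (1 : ℝ)).indicator (hζ hS)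
      have e1 : (Pr.restrict B).map ζ S = ENNReal.ofReal
          (∫ ω in B, Set.indicator {ω | ζ ω ∈ S} (fun _ => (1 : ℝ)) ω ∂Pr) := by
        have hS' : MeasurableSet {ω | ζ ω ∈ S} := hζ hS
        rw [Measure.map_apply hζ hS, integral_indicator hS']
        simp only [integral_const, smul_eq_mul, mul_one]
        rw [measureReal_restrict_apply_univ, measureReal_def, ENNReal.ofReal_toReal
          (measure_ne_top _ _)]
        rfl
      rw [e1, ← setIntegral_condExp hm hind hB,
        integral_congr_ae (ae_restrict_of_ae (hcond S hS)),
        ofReal_integral_eq_lintegral_ofReal]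
      · rw [Measure.sum_apply _ hS]
        simp_rw [Measure.smul_apply, smul_eq_mul, mul_comm _ (κ _ S),
          ← lintegral_const_mul _ (hqm' _)]
        rw [← lintegral_tsum fun z => ((hqm' z).const_mul _).aemeasurable]
        refine lintegral_congr_ae (ae_restrict_of_ae ?_)
        filter_upwards [hlaw _ (measurable_one.indicator hS)] with ω hω
        simp only [lintegral_indicator_one hS] at hω
        rw [ENNReal.ofReal_toReal (measure_ne_top _ _), hω]
      · exact (integrable_condExp.congr (hcond S hS)).integrableOn
      · exact Filter.Eventually.of_forall fun ω => ENNReal.toReal_nonneg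
    rw [← lintegral_map (μ := Pr.restrict B) hφ hζ, hmeas, lintegral_sum_measure,
      lintegral_tsum fun z => ((hqm' z).const_mul _).aemeasurable]
    refine tsum_congr fun z => ?_
    rw [lintegral_smul_measure, lintegral_const_mul _ (hqm' z), smul_eq_mul, mul_comm]
  -- Passing from past events to past functions: the two densities induce the same measure on the
  -- past, against which `Z` is then integrated.
  have htrim : (Pr.withDensity fun ω => φ (ζ ω)).trim hm =
      (Pr.withDensity fun ω => ∑' z, (∫⁻ s, φ s ∂(κ z)) * q z ω).trim hm := by
    refine @Measure.ext _ m _ _ fun B hB => ?_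
    rw [trim_measurableSet_eq hm hB, trim_measurableSet_eq hm hB,
      withDensity_apply _ (hm _ hB), withDensity_apply _ (hm _ hB), hset B hB]
  have hZ' : Measurable Z := hZ.mono hm le_rfl
  have h1 := congrArg (fun ν : @Measure Ω m => @lintegral Ω m ν Z) htrim
  simp only [lintegral_trim hm hZ] at h1
  rw [lintegral_withDensity_eq_lintegral_mul (f := fun ω => φ (ζ ω)) _ (hφ.comp hζ) hZ',
    lintegral_withDensity_eq_lintegral_mul _ hKm hZ'] at h1
  simp only [Pi.mul_apply] at h1
  simp_rw [mul_comm (Z _)]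
  refine h1.trans (lintegral_congr_ae ?_)
  filter_upwards [hlaw φ hφ] with ω hω
  rw [hω]

/-- A product of nonnegative factors with conditional means at most one has mean at most one. -/
lemma lintegral_prod_le_one {ℱ : Filtration ℕ mΩ} (n : ℕ) (G : Fin n → Ω → ℝ≥0∞)
    (hG : ∀ i : Fin n, Measurable[ℱ (i + 1)] (G i))
    (hle : ∀ (i : Fin n) (Z : Ω → ℝ≥0∞), Measurable[ℱ i] Z →
      ∫⁻ ω, Z ω * G i ω ∂Pr ≤ ∫⁻ ω, Z ω ∂Pr) :
    Measurable[ℱ n] (fun ω => ∏ i, G i ω) ∧ ∫⁻ ω, ∏ i, G i ω ∂Pr ≤ 1 := by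
  induction n with
  | zero => simp [measurable_const]
  | succ n ih =>
    obtain ⟨h1, h2⟩ := ih (fun i => G i.castSucc) (fun i => hG i.castSucc)
      fun i => hle i.castSucc
    simp_rw [Fin.prod_univ_castSucc]
    refine ⟨?_, (hle (Fin.last n) _ h1).trans h2⟩
    exact (h1.mono (ℱ.mono (Nat.le_succ n)) le_rfl).mul (hG (Fin.last n))

end Adaptive

/-! ### Concentration by an exponential supermartingale -/

section Concentration

variable {X : Type u} {A : Type v} [Countable X] [MeasurableSpace X] [DiscreteMeasurableSpace X]
  [Countable A] [MeasurableSpace A] [DiscreteMeasurableSpace A] [Nonempty A] {H : ℕ}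
  {M : MDP H X A} {Ω : Type w} [mΩ : MeasurableSpace Ω] {Pr : Measure Ω} [IsProbabilityMeasure Pr]

/-- The squared Bellman errors under the data distributions are bounded by the excess empirical
loss, up to a logarithmic term. -/
theorem MDP.IsAdaptiveData.measure_sum_sqError {n : ℕ} {μ : Fin n → Ω → Fin H → PMF (X × A)}
    {z : Fin n → Ω → Fin H → Sample X A} (hz : M.IsAdaptiveData Pr μ z) {h : Fin H}
    {g f : X → A → ℝ} (hg : ∀ x a, g x a ∈ Set.Icc (0 : ℝ) 1)
    (hf : ∀ x a, f x a ∈ Set.Icc (0 : ℝ) 1)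
    (hb : ∀ x a, M.bellman h f x a ∈ Set.Icc (0 : ℝ) 1) {δ : ℝ} (hδ : 0 < δ) :
    Pr {ω | 2 * ∑ i, M.excessLoss h g f (z i ω h) + 64 * Real.log (1 / δ) <
      ∑ i, ∫ y, M.sqError h g f y ∂(μ i ω h).toMeasure} ≤ ENNReal.ofReal δ := by
  obtain ⟨ℱ, hmeas, hcond⟩ := hz
  choose q hqm hq using fun i => M.exists_measurable_version (hcond i h)
  -- A version of the conditional squared error that is measurable with respect to the past; the
  -- given `μ` determines it only almost surely.
  let c : Fin n → Ω → ℝ := fun i ω => (∑' y, ENNReal.ofReal (M.sqError h g f y) * q i y ω).toReal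
  have hcm : ∀ i : Fin n, Measurable[ℱ i] (c i) := fun i =>
    (measurable_tsum_const_mul _ (hqm i)).ennreal_toReal
  have hc : ∀ᵐ ω ∂Pr, ∀ i, ∫ y, M.sqError h g f y ∂(μ i ω h).toMeasure = c i ω := by
    refine ae_all_iff.2 fun i => ?_
    filter_upwards [hq i] with ω hω
    rw [integral_eq_lintegral_of_nonneg_ae
      (Filter.Eventually.of_forall fun y => (M.sqError_mem_Icc hg hb y).1)
      Measurable.of_discrete.aestronglyMeasurable, lintegral_countable']
    simp_rw [PMF.toMeasure_apply_singleton _ _ (MeasurableSet.singleton _), hω]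
    rfl
  let φ : Sample X A → ℝ≥0∞ := fun s => ENNReal.ofReal (Real.exp (-M.excessLoss h g f s / 32))
  have hφ : Measurable φ := by
    have := M.measurable_excessLoss h g f
    fun_prop
  have hzh : ∀ i : Fin n, Measurable[ℱ (i + 1)] fun ω => z i ω h := fun i =>
    (measurable_pi_apply h).comp (hmeas i)
  let G : Fin n → Ω → ℝ≥0∞ := fun i ω =>
    ENNReal.ofReal (Real.exp (c i ω / 64)) * φ (z i ω h)
  have hEm : ∀ i : Fin n, Measurable[ℱ i] fun ω => ENNReal.ofReal (Real.exp (c i ω / 64)) := fun i =>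
    (Real.measurable_exp.comp ((hcm i).div_const 64)).ennreal_ofReal
  have hGm : ∀ i : Fin n, Measurable[ℱ (i + 1)] (G i) := fun i =>
    ((hEm i).mono (ℱ.mono (Nat.le_succ _)) le_rfl).mul (hφ.comp (hzh i))
  have hprod := (lintegral_prod_le_one (Pr := Pr) n G hGm fun i Z hZ => by
    have e1 : ∀ ω, Z ω * G i ω = (Z ω * ENNReal.ofReal (Real.exp (c i ω / 64))) * φ (z i ω h) :=
      fun ω => (mul_assoc _ _ _).symm
    simp_rw [e1]
    rw [M.lintegral_mul_comp (Z := fun ω => Z ω * ENNReal.ofReal (Real.exp (c i ω / 64))) (ℱ.le i) ((hzh i).mono (ℱ.le _) le_rfl) (hcond i h)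
      (hZ.mul (hEm i)) hφ]
    refine lintegral_mono_ae ?_
    filter_upwards [hc] with ω hω
    have h2 := M.lintegral_exp_excessLoss_sampleLaw hg hf hb (μ i ω h)
    rw [hω i] at h2
    rw [mul_assoc]
    refine (mul_le_mul_right (mul_le_mul_right h2 _) _).trans ?_
    rw [← ENNReal.ofReal_mul (Real.exp_pos _).le, ← Real.exp_add]
    simp [neg_div]).2
  have hGpos : ∀ ω, ∏ i, G i ω = ENNReal.ofReal
      (Real.exp ((∑ i, c i ω) / 64 - (∑ i, M.excessLoss h g f (z i ω h)) / 32)) := by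
    intro ω
    simp only [G, φ]
    simp_rw [← ENNReal.ofReal_mul (Real.exp_pos _).le, ← Real.exp_add]
    rw [← ENNReal.ofReal_prod_of_nonneg fun i _ => (Real.exp_pos _).le, ← Real.exp_sum,
      Finset.sum_add_distrib, Finset.sum_div, ← Finset.sum_div, ← Finset.sum_div,
      Finset.sum_neg_distrib, neg_div, sub_eq_add_neg]
  have hmk : AEMeasurable (fun ω => ∏ i, G i ω) Pr :=
    (Finset.measurable_prod _ fun i _ => (hGm i).mono (ℱ.le _) le_rfl).aemeasurable
  -- Multiplying `∑ c / 64 - ∑ loss / 32 ≥ log (1 / δ)` by `64` gives the constants `2` and `64`;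
  -- Markov's inequality then applies to the product.
  have hsub : Pr {ω | 2 * ∑ i, M.excessLoss h g f (z i ω h) + 64 * Real.log (1 / δ) <
      ∑ i, ∫ y, M.sqError h g f y ∂(μ i ω h).toMeasure} ≤
      Pr {ω | ENNReal.ofReal (1 / δ) ≤ ∏ i, G i ω} := by
    refine measure_mono_ae ?_
    filter_upwards [hc] with ω hω hlt
    replace hlt : 2 * ∑ i, M.excessLoss h g f (z i ω h) + 64 * Real.log (1 / δ) <
      ∑ i, ∫ y, M.sqError h g f y ∂(μ i ω h).toMeasure := hlt
    simp_rw [hω] at hlt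
    change ENNReal.ofReal (1 / δ) ≤ ∏ i, G i ω
    rw [hGpos]
    refine ENNReal.ofReal_le_ofReal ?_
    rw [← Real.exp_log (by positivity : 0 < 1 / δ)]
    exact Real.exp_le_exp.2 (by linarith)
  refine hsub.trans ((meas_ge_le_lintegral_div hmk ?_ ENNReal.ofReal_ne_top).trans ?_)
  · simpa using hδ
  · rw [one_div, ENNReal.ofReal_inv_of_pos hδ, ENNReal.div_eq_inv_mul, inv_inv]
    exact mul_le_of_le_one_right' hprod

end Concentration

/-! ### Change of measure with clipped density ratios -/

section Clipped

lemma le_ratio_of_pos {d m : ℝ≥0∞} (hd : d ≠ 0) : ratio d m = d / m := by simp [ratio, hd]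

/-- Change of measure with a clipped density ratio, for a single state-action pair. -/
lemma mul_ofReal_le_clipped {d m : ℝ≥0∞} (hd : d ≠ ∞) (hm : m ≠ ∞) {Δ c : ℝ}
    (hΔ : Δ ∈ Set.Icc (0 : ℝ) 1) (hc : 0 < c) :
    d * ENNReal.ofReal Δ ≤ ENNReal.ofReal (6 / c) * (d * min (ratio d m) (ENNReal.ofReal c)) +
      ENNReal.ofReal (c / 24) * (m * ENNReal.ofReal (Δ ^ 2)) := by
  have h6 : ENNReal.ofReal (6 / c) * (d * ENNReal.ofReal c) = d * ENNReal.ofReal 6 := by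
    rw [mul_left_comm, ← ENNReal.ofReal_mul (by positivity), div_mul_cancel₀ _ hc.ne']
  -- The clipped case: the first term alone is `6d`, and `Δ ≤ 1`.
  have hbig : d * ENNReal.ofReal Δ ≤ ENNReal.ofReal (6 / c) * (d * ENNReal.ofReal c) := by
    rw [h6]
    exact mul_le_mul_right (ENNReal.ofReal_le_ofReal (by linarith [hΔ.2])) _
  rcases eq_or_ne d 0 with rfl | hd0
  · simp
  rw [le_ratio_of_pos hd0]
  rcases le_total (ENNReal.ofReal c) (d / m) with hle | hle
  · rw [min_eq_right hle]
    exact hbig.trans le_self_add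
  rw [min_eq_left hle]
  have hm0 : m ≠ 0 := by
    rintro rfl
    rw [ENNReal.div_zero hd0] at hle
    exact ENNReal.ofReal_ne_top (top_le_iff.1 hle)
  have hm' : 0 < m.toReal := ENNReal.toReal_pos hm0 hm
  have hd' : 0 ≤ d.toReal := ENNReal.toReal_nonneg
  rw [← ENNReal.ofReal_toReal hd, ← ENNReal.ofReal_toReal hm, ← ENNReal.ofReal_div_of_pos hm',
    ← ENNReal.ofReal_mul hd', ← ENNReal.ofReal_mul hd', ← ENNReal.ofReal_mul (by positivity),
    ← ENNReal.ofReal_mul hm'.le, ← ENNReal.ofReal_mul (by positivity),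
    ← ENNReal.ofReal_add (by positivity) (by positivity)]
  refine ENNReal.ofReal_le_ofReal ?_
  -- A perfect square because `4 · 6 · (1/24) = 1`: the weight `6` forces the weight `1/24` on the
  -- second moment.
  have e : 6 / c * (d.toReal * (d.toReal / m.toReal)) + c / 24 * (m.toReal * Δ ^ 2) -
      d.toReal * Δ = 6 / (c * m.toReal) * (d.toReal - c * m.toReal * Δ / 12) ^ 2 := by
    field_simp
    ring
  have : 0 ≤ 6 / (c * m.toReal) * (d.toReal - c * m.toReal * Δ / 12) ^ 2 := by positivity
  linarith

/-- If the ratio is clipped, the first term is already `c d`; otherwise `d ≤ c m`. Summed over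
pairs, this bounds clipped coefficients from below. -/
lemma ofReal_mul_le_clipped (d : ℝ≥0∞) {m : ℝ≥0∞} (hm : m ≠ ∞) {c : ℝ} :
    ENNReal.ofReal c * d ≤ d * min (ratio d m) (ENNReal.ofReal c) +
      ENNReal.ofReal c * (ENNReal.ofReal c * m) := by
  rcases eq_or_ne d 0 with rfl | hd0
  · simp
  rw [le_ratio_of_pos hd0]
  rcases le_total (ENNReal.ofReal c) (d / m) with hle | hle
  · rw [min_eq_right hle, mul_comm]
    exact le_self_add
  · have hm0 : m ≠ 0 := by
      rintro rfl
      rw [ENNReal.div_zero hd0] at hle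
      exact ENNReal.ofReal_ne_top (top_le_iff.1 hle)
    refine le_add_left (mul_le_mul_right ?_ _)
    exact (ENNReal.div_le_iff hm0 hm).1 hle

variable {X : Type u} {A : Type v}

lemma tsum_clipped_le {d m : X × A → ℝ≥0∞} (hd : ∑' z, d z = 1) (c : ℝ) :
    ∑' z, d z * min (ratio (d z) (m z)) (ENNReal.ofReal c) ≤ ENNReal.ofReal c :=
  calc _ ≤ ∑' z, d z * ENNReal.ofReal c :=
        ENNReal.tsum_le_tsum fun z => mul_le_mul_right (min_le_right _ _) _
    _ = _ := by rw [ENNReal.tsum_mul_right, hd, one_mul]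

lemma ofReal_ccc {d m : X × A → ℝ≥0∞} (hd : ∑' z, d z = 1) (c : ℝ) :
    ENNReal.ofReal (ccc d m c) = ∑' z, d z * min (ratio (d z) (m z)) (ENNReal.ofReal c) :=
  ENNReal.ofReal_toReal ((tsum_clipped_le hd c).trans_lt ENNReal.ofReal_lt_top).ne

lemma ccc_nonneg (d m : X × A → ℝ≥0∞) (c : ℝ) : 0 ≤ ccc d m c := ENNReal.toReal_nonneg

/-- Clipped concentrability coefficients at small scales are bounded from below. -/
lemma mul_one_sub_le_ccc {d m : X × A → ℝ≥0∞} (hd : ∑' z, d z = 1) (hm : ∑' z, m z = 1) {c : ℝ}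
    (hc : 0 ≤ c) : c * (1 - c) ≤ ccc d m c := by
  have h1 : ENNReal.ofReal c ≤ ENNReal.ofReal (ccc d m c + c * c) := by
    rw [ENNReal.ofReal_add (ccc_nonneg _ _ _) (mul_nonneg hc hc), ofReal_ccc hd,
      ENNReal.ofReal_mul hc]
    calc ENNReal.ofReal c = ∑' z, ENNReal.ofReal c * d z := by
          rw [ENNReal.tsum_mul_left, hd, mul_one]
      _ ≤ ∑' z, (d z * min (ratio (d z) (m z)) (ENNReal.ofReal c) +
          ENNReal.ofReal c * (ENNReal.ofReal c * m z)) :=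
          ENNReal.tsum_le_tsum fun z => ofReal_mul_le_clipped _
            (ENNReal.ne_top_of_tsum_ne_top (hm ▸ ENNReal.one_ne_top) z)
      _ = _ := by
          rw [ENNReal.tsum_add, ENNReal.tsum_mul_left, ENNReal.tsum_mul_left, hm, mul_one]
  have h2 := (ENNReal.ofReal_le_ofReal_iff (add_nonneg (ccc_nonneg _ _ _) (mul_nonneg hc hc))).1 h1
  linarith

lemma tsum_mixture_mul {H n : ℕ} (μ : Fin n → Fin H → PMF (X × A)) (h : Fin H)
    (φ : X × A → ℝ≥0∞) :
    ∑' z, mixture μ h z * φ z = (∑ i, ∑' z, μ i h z * φ z) / n := by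
  rw [← Summable.tsum_finsetSum fun _ _ => ENNReal.summable, div_eq_mul_inv,
    ← ENNReal.tsum_mul_right]
  refine tsum_congr fun z => ?_
  rw [mixture, div_eq_mul_inv, mul_right_comm, Finset.sum_mul]

lemma tsum_mixture {H n : ℕ} (hn : 0 < n) (μ : Fin n → Fin H → PMF (X × A)) (h : Fin H) :
    ∑' z, mixture μ h z = 1 := by
  have := tsum_mixture_mul μ h (fun _ => 1)
  simp only [mul_one, PMF.tsum_coe] at this
  rw [this]
  simpa using ENNReal.div_self (by exact_mod_cast hn.ne') (ENNReal.natCast_ne_top n)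

lemma mixture_ne_top {H n : ℕ} (hn : 0 < n) (μ : Fin n → Fin H → PMF (X × A)) (h : Fin H)
    (z : X × A) : mixture μ h z ≠ ∞ :=
  (ENNReal.div_lt_top (ENNReal.sum_ne_top.2 fun i _ => PMF.apply_ne_top _ _)
    (by exact_mod_cast hn.ne')).ne

variable [Countable X] [MeasurableSpace X] [DiscreteMeasurableSpace X]
  [Countable A] [MeasurableSpace A] [DiscreteMeasurableSpace A]

lemma lintegral_pmf (d : PMF (X × A)) (φ : X × A → ℝ≥0∞) :
    ∫⁻ z, φ z ∂d.toMeasure = ∑' z, d z * φ z := by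
  rw [lintegral_countable']
  simp_rw [PMF.toMeasure_apply_singleton _ _ (MeasurableSet.singleton _), mul_comm]

lemma ofReal_integral_pmf (d : PMF (X × A)) {φ : X × A → ℝ} (hφ : ∀ z, φ z ∈ Set.Icc (0 : ℝ) 1) :
    ENNReal.ofReal (∫ z, φ z ∂d.toMeasure) = ∑' z, d z * ENNReal.ofReal (φ z) := by
  rw [ofReal_integral_eq_lintegral_ofReal (integrable_of_mem_Icc Measurable.of_discrete
    (Filter.Eventually.of_forall hφ)) (Filter.Eventually.of_forall fun z => (hφ z).1),
    lintegral_pmf]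

/-- Change of measure with clipped density ratios: an expectation under `d` is bounded by the
second moments under `μ_1, …, μ_n`. -/
lemma integral_le_clipped {H n : ℕ} (hn : 0 < n) (d : PMF (X × A))
    (μ : Fin n → Fin H → PMF (X × A)) (h : Fin H) {Δ : X × A → ℝ}
    (hΔ : ∀ z, Δ z ∈ Set.Icc (0 : ℝ) 1) {γ : ℝ} (hγ : 0 < γ) :
    ∫ z, Δ z ∂d.toMeasure ≤ 6 / γ / n * ccc d (mixture μ h) (γ * n) +
      γ / 24 * ∑ i, ∫ z, Δ z ^ 2 ∂(μ i h).toMeasure := by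
  have hn' : (0 : ℝ) < n := by exact_mod_cast hn
  have hc : 0 < γ * n := mul_pos hγ hn'
  have hΔ2 : ∀ z, Δ z ^ 2 ∈ Set.Icc (0 : ℝ) 1 := fun z =>
    ⟨sq_nonneg _, pow_le_one₀ (hΔ z).1 (hΔ z).2⟩
  have hS : 0 ≤ ∑ i, ∫ z, Δ z ^ 2 ∂(μ i h).toMeasure :=
    Finset.sum_nonneg fun i _ => integral_nonneg fun z => (hΔ2 z).1
  have hcc := ccc_nonneg d (mixture μ h) (γ * n)
  have e1 : 6 / γ / n = 6 / (γ * n) := div_div _ _ _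
  rw [e1, ← ENNReal.ofReal_le_ofReal_iff (by positivity), ofReal_integral_pmf d hΔ,
    ENNReal.ofReal_add (by positivity) (by positivity), ENNReal.ofReal_mul (by positivity),
    ofReal_ccc (PMF.tsum_coe d)]
  have e2 : ENNReal.ofReal (γ / 24 * ∑ i, ∫ z, Δ z ^ 2 ∂(μ i h).toMeasure) =
      ENNReal.ofReal (γ * n / 24) * ∑' z, mixture μ h z * ENNReal.ofReal (Δ z ^ 2) := by
    rw [tsum_mixture_mul]
    simp_rw [← fun i => ofReal_integral_pmf (μ i h) hΔ2]
    rw [← ENNReal.ofReal_sum_of_nonneg fun i _ => integral_nonneg fun z => (hΔ2 z).1,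
      ← ENNReal.ofReal_natCast, ← ENNReal.ofReal_div_of_pos hn',
      ← ENNReal.ofReal_mul (by positivity)]
    congr 1
    field_simp
  rw [e2, ← ENNReal.tsum_mul_left, ← ENNReal.tsum_mul_left, ← ENNReal.tsum_add]
  exact ENNReal.tsum_le_tsum fun z => mul_ofReal_le_clipped (PMF.apply_ne_top _ _)
    (mixture_ne_top hn μ h z) (hΔ z) hc

end Clipped

/-! ### The regret bound for Fitted Q-Iteration -/

section FQI

variable {X : Type u} {A : Type v} {H : ℕ} {F : Finset (QFun H X A)}

lemma Layerwise.mem_Icc (hF : ∀ f ∈ F, ∀ h x a, f h x a ∈ Set.Icc (0 : ℝ) 1) {f : QFun H X A}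
    (hf : Layerwise F f) (h : Fin H) (x : X) (a : A) : f h x a ∈ Set.Icc (0 : ℝ) 1 := by
  obtain ⟨g, hg, e⟩ := hf h
  exact e ▸ hF g hg h x a

/-- A layerwise function may combine different members of `F`, but a regression target involves only
one of its components. Completeness thus extends to such functions, and a union over `|F|²` pairs
per layer is enough. -/
lemma Layerwise.exists_nextQ_eq (hne : F.Nonempty) {f : QFun H X A} (hf : Layerwise F f)
    (h : Fin H) : ∃ g ∈ F, nextQ g h = nextQ f h := by
  by_cases hh : h.val + 1 < H
  · obtain ⟨g, hg, e⟩ := hf ⟨h.val + 1, hh⟩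
    exact ⟨g, hg, by simp only [nextQ, hh, dif_pos, e]⟩
  · obtain ⟨g, hg⟩ := hne
    exact ⟨g, hg, by simp only [nextQ, hh, dif_neg, not_false_iff]⟩

variable [Countable X] [MeasurableSpace X] [DiscreteMeasurableSpace X]
  [Countable A] [MeasurableSpace A] [DiscreteMeasurableSpace A] {M : MDP H X A}

lemma BellmanComplete.exists_bellman_eq (hM : BellmanComplete F M) (hne : F.Nonempty)
    {f : QFun H X A} (hf : Layerwise F f) (h : Fin H) :
    ∃ g ∈ F, g h = M.bellman h (nextQ f h) := by
  obtain ⟨f', hf', e⟩ := hf.exists_nextQ_eq hne h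
  exact e ▸ hM h f' hf'

/-- Fitted Q-Iteration has nonpositive excess empirical loss. -/
lemma IsFQISolution.sum_excessLoss_nonpos {n : ℕ} (hn : 0 < n) (hM : BellmanComplete F M)
    (hne : F.Nonempty) {D : Dataset H n X A} {f : QFun H X A} (hf : IsFQISolution F D f)
    (h : Fin H) : ∑ i, M.excessLoss h (f h) (nextQ f h) (D i h) ≤ 0 := by
  -- The Bellman backup lies in the class, hence is a competitor in the regression.
  obtain ⟨g, hg, e⟩ := hM.exists_bellman_eq hne hf.1 h
  have h1 := hf.2 h g hg
  have hn' : (0 : ℝ) < n := by exact_mod_cast hn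
  rw [sqLoss, sqLoss, div_le_div_iff_of_pos_right hn', e] at h1
  simp only [MDP.excessLoss]
  rw [Finset.sum_sub_distrib]
  linarith

/-- The event that all excess losses concentrate. -/
lemma MDP.IsAdaptiveData.measure_exists_sqError [Nonempty A] {Ω : Type w} [MeasurableSpace Ω]
    {Pr : Measure Ω} [IsProbabilityMeasure Pr] {n : ℕ} {μ : Fin n → Ω → Fin H → PMF (X × A)}
    {z : Fin n → Ω → Fin H → Sample X A} (hz : M.IsAdaptiveData Pr μ z) (hH : 0 < H)
    (hne : F.Nonempty) (hF : ∀ f ∈ F, ∀ h x a, f h x a ∈ Set.Icc (0 : ℝ) 1)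
    (hM : BellmanComplete F M) {δ : ℝ} (hδ : 0 < δ) :
    Pr {ω | ∃ (h : Fin H), ∃ g ∈ F, ∃ f ∈ F,
      2 * ∑ i, M.excessLoss h (g h) (nextQ f h) (z i ω h) +
        64 * Real.log (1 / (δ / (H * F.card ^ 2))) <
      ∑ i, ∫ y, M.sqError h (g h) (nextQ f h) y ∂(μ i ω h).toMeasure} ≤ ENNReal.ofReal δ := by
  have hH' : (0 : ℝ) < H := by exact_mod_cast hH
  have hc : (0 : ℝ) < F.card := by exact_mod_cast hne.card_pos
  set δ' := δ / (H * (F.card : ℝ) ^ 2) with hδ'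
  have hδ'0 : 0 < δ' := by positivity
  let E : Fin H × QFun H X A × QFun H X A → Set Ω := fun p => {ω |
    2 * ∑ i, M.excessLoss p.1 (p.2.1 p.1) (nextQ p.2.2 p.1) (z i ω p.1) +
        64 * Real.log (1 / δ') <
      ∑ i, ∫ y, M.sqError p.1 (p.2.1 p.1) (nextQ p.2.2 p.1) y ∂(μ i ω p.1).toMeasure}
  have hE : ∀ p ∈ (Finset.univ ×ˢ F ×ˢ F : Finset (Fin H × QFun H X A × QFun H X A)),
      Pr (E p) ≤ ENNReal.ofReal δ' := by
    rintro ⟨h, g, f⟩ hp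
    simp only [Finset.mem_product, Finset.mem_univ, true_and] at hp
    obtain ⟨b, hb, e⟩ := hM h f hp.2
    exact hz.measure_sum_sqError (hF g hp.1 h) (nextQ_mem_Icc (hF f hp.2) h)
      (fun x a => e ▸ hF b hb h x a) hδ'0
  calc _ ≤ Pr (⋃ p ∈ (Finset.univ ×ˢ F ×ˢ F : Finset (Fin H × QFun H X A × QFun H X A)), E p) := by
        refine measure_mono ?_
        rintro ω ⟨h, g, hg, f, hf, hlt⟩
        exact Set.mem_biUnion (x := (h, g, f)) (by simp [hg, hf]) hlt
    _ ≤ ∑ p ∈ (Finset.univ ×ˢ F ×ˢ F : Finset (Fin H × QFun H X A × QFun H X A)), Pr (E p) :=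
        measure_biUnion_finset_le _ _
    _ ≤ ∑ p ∈ (Finset.univ ×ˢ F ×ˢ F : Finset (Fin H × QFun H X A × QFun H X A)),
        ENNReal.ofReal δ' := Finset.sum_le_sum hE
    _ = ENNReal.ofReal δ := by
        rw [Finset.sum_const, nsmul_eq_mul, ← ENNReal.ofReal_natCast,
          ← ENNReal.ofReal_mul (by positivity)]
        congr 1
        simp only [Finset.card_product, Finset.card_univ, Fintype.card_fin, Nat.cast_mul, hδ']
        field_simp

/-- If the excess losses concentrate, then the regret of Fitted Q-Iteration is bounded in terms
of clipped concentrability coefficients. -/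
lemma IsFQISolution.regret_le [Nonempty A] {n : ℕ} (hn : 0 < n) (hM : BellmanComplete F M)
    (hne : F.Nonempty) (hF : ∀ f ∈ F, ∀ h x a, f h x a ∈ Set.Icc (0 : ℝ) 1)
    {D : Dataset H n X A} {f : QFun H X A} (hf : IsFQISolution F D f)
    {sel : QFun H X A → Fin H → X → A} (hsel : IsGreedySelector F sel)
    (μ : Fin n → Fin H → PMF (X × A)) {β : ℝ}
    (hβ : ∀ (h : Fin H), ∀ g ∈ F, ∀ f ∈ F,
      ∑ i, ∫ y, M.sqError h (g h) (nextQ f h) y ∂(μ i h).toMeasure ≤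
        2 * ∑ i, M.excessLoss h (g h) (nextQ f h) (D i h) + β)
    {γ : ℝ} (hγ : 0 < γ) (π : Policy H X A) :
    M.J π - M.J (detPolicy (sel f)) ≤
      ∑ h, (6 / γ / n * (ccc (M.occ π h) (mixture μ h) (γ * n) +
        ccc (M.occ (detPolicy (sel f)) h) (mixture μ h) (γ * n)) + β * γ / 12) := by
  refine (M.J_sub_le_sum_bellman_error (hf.1.mem_Icc hF) (hsel f hf.1) π).trans
    (Finset.sum_le_sum fun h _ => ?_)
  have hocc : ∀ π : Policy H X A, M.occ π h = M.occPMF π h := fun π =>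
    funext fun z => (M.occPMF_apply π h z).symm
  obtain ⟨g, hg, eg⟩ := hf.1 h
  obtain ⟨f', hf', ef⟩ := hf.1.exists_nextQ_eq hne h
  obtain ⟨b, hb, eb⟩ := hM.exists_bellman_eq hne hf.1 h
  set Δ : X × A → ℝ := fun z => |f h z.1 z.2 - M.bellman h (nextQ f h) z.1 z.2| with hΔdef
  have hΔ : ∀ z, Δ z ∈ Set.Icc (0 : ℝ) 1 := by
    intro z
    have h1 := hf.1.mem_Icc hF h z.1 z.2
    have h2 := hF b hb h z.1 z.2
    rw [eb] at h2
    exact ⟨abs_nonneg _, abs_le.2 ⟨by linarith [h1.1, h2.2], by linarith [h1.2, h2.1]⟩⟩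
  have hsum : ∑ i, ∫ z, Δ z ^ 2 ∂(μ i h).toMeasure ≤ β := by
    have h1 := hβ h g hg f' hf'
    rw [eg, ef] at h1
    have h2 := hf.sum_excessLoss_nonpos hn hM hne h
    simp only [hΔdef, sq_abs]
    change ∑ i, ∫ y, M.sqError h (f h) (nextQ f h) y ∂(μ i h).toMeasure ≤ β
    linarith
  have h1 := fun π : Policy H X A => integral_le_clipped hn (M.occPMF π h) μ h hΔ hγ
  rw [hocc, hocc]
  have h2 := h1 π
  have h3 := h1 (detPolicy (sel f))
  -- This is paid once for each of the two occupancies, giving `β γ / 12` in total.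
  have h4 : γ / 24 * ∑ i, ∫ z, Δ z ^ 2 ∂(μ i h).toMeasure ≤ γ / 24 * β :=
    mul_le_mul_of_nonneg_left hsum (by positivity)
  calc _ ≤ _ := add_le_add h2 h3
    _ ≤ _ := by linarith

/-- At sample sizes below the horizon, the regret bound holds trivially. -/
lemma one_le_sum_clipped {n : ℕ} (hn : 0 < n) (hnH : n < H) {L : ℝ} (hL : 1 / 2 ≤ L)
    (μ : Fin n → Fin H → PMF (X × A)) {γ : ℝ} (hγ : 0 < γ) (π π' : Policy H X A) :
    1 ≤ ∑ h, (6 / γ / n * (ccc (M.occ π h) (mixture μ h) (γ * n) +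
      ccc (M.occ π' h) (mixture μ h) (γ * n)) + 1024 * L * γ) := by
  have hn' : (0 : ℝ) < n := by exact_mod_cast hn
  have hn1 : (1 : ℝ) ≤ n := by exact_mod_cast hn
  have hH' : (n : ℝ) < H := by exact_mod_cast hnH
  -- If `γ n ≤ 1/2`, the lower bound on one clipped coefficient makes the first term at least `3`.
  -- Otherwise `1/n ≤ 2γ`, and the last term exceeds `1/n ≥ 1/H`.
  have hterm : ∀ h : Fin H, 1 / (H : ℝ) ≤ 6 / γ / n * (ccc (M.occ π h) (mixture μ h) (γ * n) +
      ccc (M.occ π' h) (mixture μ h) (γ * n)) + 1024 * L * γ := by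
    intro h
    have hH1 : 1 / (H : ℝ) ≤ 1 / n := one_div_le_one_div_of_le hn' hH'.le
    have h11 : 1 / (n : ℝ) ≤ 1 := by rw [div_le_one hn']; exact hn1
    have hc0 := ccc_nonneg (M.occ π h) (mixture μ h) (γ * n)
    have hc0' := ccc_nonneg (M.occ π' h) (mixture μ h) (γ * n)
    rcases le_total (γ * n) (1 / 2) with hc | hc
    · have h1 := mul_one_sub_le_ccc (M.tsum_occ π h) (tsum_mixture hn μ h)
        (c := γ * n) (by positivity)
      have h2 : 1 / 2 * (γ * n) ≤ ccc (M.occ π h) (mixture μ h) (γ * n) := by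
        nlinarith [mul_pos hγ hn']
      have h3 : 6 / γ / n * (1 / 2 * (γ * n)) ≤ 6 / γ / n *
          (ccc (M.occ π h) (mixture μ h) (γ * n) + ccc (M.occ π' h) (mixture μ h) (γ * n)) :=
        mul_le_mul_of_nonneg_left (by linarith) (by positivity)
      have h4 : 6 / γ / n * (1 / 2 * (γ * n)) = 3 := by field_simp; norm_num
      have h5 : 0 ≤ 1024 * L * γ := by positivity
      linarith
    · have h1 : 1 / (n : ℝ) ≤ 2 * γ := by
        rw [div_le_iff₀ hn']
        linarith
      have h2 : 0 ≤ 6 / γ / n * (ccc (M.occ π h) (mixture μ h) (γ * n) +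
        ccc (M.occ π' h) (mixture μ h) (γ * n)) := by positivity
      nlinarith
  calc (1 : ℝ) = ∑ _h : Fin H, 1 / (H : ℝ) := by
        have : (H : ℝ) ≠ 0 := (hn'.trans hH').ne'
        simp [this]
    _ ≤ _ := Finset.sum_le_sum fun h _ => hterm h

lemma half_le_log_two_mul {k : ℕ} (hk : 0 < k) (hne : F.Nonempty) {δ : ℝ} (hδ : 0 < δ)
    (hδ1 : δ < 1) : 1 / 2 ≤ Real.log (2 * k * F.card / δ) := by
  have hk' : (1 : ℝ) ≤ k := by exact_mod_cast hk
  have hc : (1 : ℝ) ≤ F.card := by exact_mod_cast hne.card_pos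
  have h2 : (2 : ℝ) ≤ 2 * k * F.card / δ := by
    rw [le_div_iff₀ hδ]
    nlinarith
  have := Real.log_le_log (by norm_num) h2
  linarith [Real.log_two_gt_d9]

/-- Fitted Q-Iteration is CC-bounded for all scales simultaneously. -/
theorem ccBounded_fqi {sel : QFun H X A → Fin H → X → A} {alg : OfflineAlg H X A} {δ : ℝ}
    (hne : F.Nonempty) (hF : ∀ f ∈ F, ∀ h x a, f h x a ∈ Set.Icc (0 : ℝ) 1)
    (hsel : IsGreedySelector F sel) (halg : IsFQI F sel alg) (hδ : 0 < δ) (hδ1 : δ < 1) :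
    CCBounded.{u, v, w} alg (policyClass F sel) (fun _ M => BellmanComplete F M) (Set.Ioi 0)
      (fun γ => 6 / γ)
      (fun n γ => 1024 * Real.log (2 * (min n H : ℕ) * F.card / δ) * γ) δ := by
  refine ⟨fun n D => ?_, ?_⟩
  · obtain ⟨f, hf, e⟩ := halg n D
    exact ⟨f, hf.1, e⟩
  intro M πs hnorm _ Ω _ Pr _ n μ z hn hz hcond
  have hM : BellmanComplete F M := hcond.exists.choose_spec
  rcases Nat.eq_zero_or_pos H with rfl | hH
  · simp [MDP.J]
  -- Some state exists because the initial law is a probability, and the selector then supplies an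
  -- action.
  have hA : Nonempty A := by
    obtain ⟨x, -⟩ := M.init.support_nonempty
    exact ⟨sel (fun _ _ _ => 0) ⟨0, hH⟩ x⟩
  rcases lt_or_ge n H with hnH | hnH
  · refine le_of_eq_of_le (measure_mono_null (t := ∅) ?_ measure_empty) zero_le
    intro ω hω
    refine hω fun γ hγ => ?_
    have hJ : M.J πs - M.J (alg n fun i => z i ω) ≤ 1 := by
      linarith [(hnorm.J_mem_Icc πs).2, (hnorm.J_mem_Icc (alg n fun i => z i ω)).1]
    refine hJ.trans ?_
    simp only [min_eq_left hnH.le]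
    exact one_le_sum_clipped hn hnH (half_le_log_two_mul hn hne hδ hδ1) _ hγ _ _
  · refine le_trans (measure_mono ?_) (hz.measure_exists_sqError hH hne hF hM hδ)
    intro ω hω
    by_contra hgood
    refine hω fun γ hγ => ?_
    change ¬ ∃ (h : Fin H), ∃ g ∈ F, ∃ f ∈ F, _ at hgood
    push Not at hgood
    obtain ⟨f, hf, e⟩ := halg n fun i => z i ω
    simp only [e, min_eq_right hnH]
    refine (hf.regret_le hn hM hne hF hsel (fun i => μ i ω) hgood hγ πs).trans
      (Finset.sum_le_sum fun h _ => ?_)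
    refine add_le_add le_rfl ?_
    have hH' : (1 : ℝ) ≤ H := by exact_mod_cast hH
    have hc : (1 : ℝ) ≤ F.card := by exact_mod_cast hne.card_pos
    have hL := half_le_log_two_mul hH hne hδ hδ1
    -- The square in the union bound becomes a factor `2`, using `δ < 1`. The slope is therefore at
    -- most `64 · 2 / 12` times the logarithm, well below `1024`.
    have hlog : Real.log (1 / (δ / (H * (F.card : ℝ) ^ 2))) ≤
        2 * Real.log (2 * H * F.card / δ) := by
      rw [← Real.log_rpow (by positivity)]
      refine Real.log_le_log (by positivity) ?_
      rw [one_div_div, Real.rpow_two, div_pow, div_le_div_iff₀ hδ (by positivity)]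
      have h1 : δ ^ 2 ≤ δ := by nlinarith
      have h2 : H * (F.card : ℝ) ^ 2 ≤ (2 * H * F.card) ^ 2 := by
        have : (0 : ℝ) ≤ (F.card : ℝ) ^ 2 := by positivity
        nlinarith
      -- After clearing denominators, one factor `δ` is spent on `δ² ≤ δ`.
      calc _ ≤ H * (F.card : ℝ) ^ 2 * δ := mul_le_mul_of_nonneg_left h1 (by positivity)
        _ ≤ _ := mul_le_mul_of_nonneg_right h2 hδ.le
    have hγ' : 0 < γ := hγ
    nlinarith

end FQI

/-! ### A potential argument with burn-in -/

section Potential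

/-- Elliptic-potential bound with burn-in: the clipped ratios of a sequence bounded by `B` to its
partial sums add up logarithmically. -/
lemma sum_clipped_potential_le {d : ℕ → ℝ} {B γ : ℝ} (hB : 0 ≤ B) (hγ : 0 ≤ γ)
    (hd : ∀ t, d t ∈ Set.Icc 0 B) {T : ℕ} (hT : 0 < T) :
    ∑ t ∈ Finset.range T, (if ∑ s ∈ Finset.range t, d s < B then γ * d t
      else d t ^ 2 / ∑ s ∈ Finset.range t, d s) ≤ B * (2 * γ + 2 * Real.log T) := by
  rcases hB.eq_or_lt with rfl | hB
  · have h0 : ∀ t, d t = 0 := fun t => le_antisymm (hd t).2 (hd t).1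
    simp [h0]
  set S : ℕ → ℝ := fun t => ∑ s ∈ Finset.range t, d s with hS
  have hSn : ∀ t, 0 ≤ S t := fun t => Finset.sum_nonneg fun s _ => (hd s).1
  -- The first summand pays for the burn-in, where the partial sum stays below `2B` even after the
  -- next step. The second pays afterwards, where `d² / S ≤ B u ≤ 2B log (1 + u)` with `u = d / S ≤
  -- 1`.
  have key : ∀ t, ∑ t ∈ Finset.range t, (if S t < B then γ * d t else d t ^ 2 / S t) ≤
      γ * min (S t) (2 * B) + 2 * B * Real.log (max (S t) B / B) := by
    intro t
    induction t with
    | zero => simp [hS, hB.le, hB.ne']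
    | succ t ih =>
      have hs : S (t + 1) = S t + d t := Finset.sum_range_succ _ _
      have hd0 := (hd t).1
      have hdB := (hd t).2
      have hmono : Real.log (max (S t) B / B) ≤ Real.log (max (S (t + 1)) B / B) := by
        refine Real.log_le_log (div_pos (lt_max_of_lt_right hB) hB) ?_
        gcongr
        linarith
      rw [Finset.sum_range_succ]
      split_ifs with hlt
      · have h1 : min (S t) (2 * B) = S t := min_eq_left (by linarith)
        have h2 : min (S (t + 1)) (2 * B) = S t + d t := by rw [hs]; exact min_eq_left (by linarith)
        rw [h1] at ih
        rw [h2]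
        nlinarith
      · push Not at hlt
        have hSt : 0 < S t := hB.trans_le hlt
        have h1 : γ * min (S t) (2 * B) ≤ γ * min (S (t + 1)) (2 * B) := by
          gcongr
          linarith
        have h2 : max (S t) B = S t := max_eq_left hlt
        have h3 : max (S (t + 1)) B = S t * (1 + d t / S t) := by
          rw [max_eq_left (by linarith), hs]
          field_simp
        have hu0 : 0 ≤ d t / S t := by positivity
        have hu1 : d t / S t ≤ 1 := (div_le_one hSt).2 (by linarith)
        have h4 : Real.log (max (S (t + 1)) B / B) = Real.log (max (S t) B / B) +
            Real.log (1 + d t / S t) := by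
          rw [h3, h2, mul_div_right_comm, Real.log_mul (by positivity) (by positivity)]
        have h5 : d t / S t ≤ 2 * Real.log (1 + d t / S t) := by
          have h6 := Real.one_sub_inv_le_log_of_pos (by positivity : 0 < 1 + d t / S t)
          have h7 : d t / S t / 2 ≤ 1 - (1 + d t / S t)⁻¹ := by
            set y := d t / S t
            rw [le_sub_iff_add_le, ← le_sub_iff_add_le', inv_le_iff_one_le_mul₀ (by positivity)]
            nlinarith
          linarith
        have h8 : d t ^ 2 / S t ≤ B * (d t / S t) := by
          rw [pow_two, mul_div_assoc]
          exact mul_le_mul_of_nonneg_right hdB hu0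
        have h9 : B * (d t / S t) ≤ B * (2 * Real.log (1 + d t / S t)) :=
          mul_le_mul_of_nonneg_left h5 hB.le
        rw [h4]
        linarith
  refine (key T).trans ?_
  have hT1 : (1 : ℝ) ≤ T := by exact_mod_cast hT
  have hST : S T ≤ T * B := by
    refine (Finset.sum_le_card_nsmul _ _ B fun s _ => (hd s).2).trans ?_
    simp
  have h1 : γ * min (S T) (2 * B) ≤ γ * (2 * B) := mul_le_mul_of_nonneg_left (min_le_right _ _) hγ
  have h2 : Real.log (max (S T) B / B) ≤ Real.log T := by
    refine Real.log_le_log (div_pos (lt_max_of_lt_right hB) hB) ?_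
    rw [div_le_iff₀ hB]
    exact max_le hST (by nlinarith)
  nlinarith

end Potential

/-! ### Concentrability and coverability as domination of occupancies -/

section Coverage

variable {X : Type u} {A : Type v}

lemma le_mul_of_ratio_le {d m C : ℝ≥0∞} (hm : m ≠ ∞) (hC : C ≠ ∞) (h : ratio d m ≤ C) :
    d ≤ C * m := by
  rcases eq_or_ne d 0 with rfl | hd
  · simp
  rw [le_ratio_of_pos hd] at h
  have hm0 : m ≠ 0 := by
    rintro rfl
    rw [ENNReal.div_zero hd] at h
    exact hC (top_le_iff.1 h)
  exact (ENNReal.div_le_iff hm0 hm).1 h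

/-- The factor `d` neutralises the convention `0/0 = 1`, which would otherwise require `1 ≤ C`. -/
lemma mul_ratio_le {d m C : ℝ≥0∞} (h : d ≤ C * m) : d * ratio d m ≤ d * C := by
  rcases eq_or_ne d 0 with rfl | hd
  · simp
  rw [le_ratio_of_pos hd]
  have hm0 : m ≠ 0 := by
    rintro rfl
    simp_all
  refine mul_le_mul_right ?_ _
  rcases eq_or_ne m ∞ with rfl | hm
  · simp
  · exact (ENNReal.div_le_iff hm0 hm).2 h

lemma ratio_le_of_le_mul {d m C : ℝ≥0∞} (hC : 1 ≤ C) (h : d ≤ C * m) : ratio d m ≤ C := by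
  unfold ratio
  split_ifs with h0
  · exact hC
  · exact ENNReal.div_le_of_le_mul h

variable [Countable X] [MeasurableSpace X] [DiscreteMeasurableSpace X]
  [Countable A] [MeasurableSpace A] [DiscreteMeasurableSpace A] {H : ℕ} {M : MDP H X A}

lemma policyClass_finite (F : Finset (QFun H X A)) (sel : QFun H X A → Fin H → X → A) :
    (policyClass F sel).Finite := by
  have h1 : {f : QFun H X A | Layerwise F f}.Finite :=
    (Set.Finite.pi' (t := fun h : Fin H => (fun g : QFun H X A => g h) '' (F : Set (QFun H X A)))
      fun h => F.finite_toSet.image _).subset fun f hf h => hf h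
  exact (h1.image fun f => detPolicy (sel f)).subset fun π ⟨f, hf, e⟩ => ⟨f, hf, e.symm⟩

/-- The coverability coefficient of a finite policy class is finite. -/
lemma MDP.cov_ne_top {Pol : Set (Policy H X A)} (hfin : Pol.Finite) (hne : Pol.Nonempty) :
    M.cov Pol ≠ ∞ := by
  set s := hfin.toFinset with hs
  have hsne : s.Nonempty := by simpa [hs] using hne
  have hcard : (s.card : ℝ≥0∞) ≠ 0 := by exact_mod_cast hsne.card_pos.ne'
  -- The uniform mixture of the occupancies dominates each of them up to the cardinality of the
  -- class.
  let μ : Fin H → PMF (X × A) := fun h => (PMF.uniformOfFinset s hsne).bind fun π => M.occPMF π h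
  have hle : M.cov Pol ≤ (s.card : ℝ≥0∞) := by
    refine iInf_le_of_le μ (iSup₂_le fun π hπ => iSup_le fun h => iSup_le fun z => ?_)
    have hπs : π ∈ s := by simpa [hs] using hπ
    refine ratio_le_of_le_mul (by exact_mod_cast hsne.card_pos) ?_
    have h1 : (s.card : ℝ≥0∞)⁻¹ * M.occ π h z ≤ μ h z := by
      rw [PMF.bind_apply, ← M.occPMF_apply, ← PMF.uniformOfFinset_apply_of_mem hsne hπs]
      exact ENNReal.le_tsum (f := fun π' => PMF.uniformOfFinset s hsne π' * M.occPMF π' h z) π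
    calc M.occ π h z = s.card * ((s.card : ℝ≥0∞)⁻¹ * M.occ π h z) := by
          rw [← mul_assoc, ENNReal.mul_inv_cancel hcard (ENNReal.natCast_ne_top _), one_mul]
      _ ≤ _ := mul_le_mul_right h1 _
  exact (hle.trans_lt (ENNReal.natCast_lt_top _)).ne

/-- The slack `+ 1` avoids asking whether the infimum is attained; the final bound absorbs it
because the concentrability constant is at least one. -/
lemma MDP.exists_covering {Pol : Set (Policy H X A)} (hcov : M.cov Pol ≠ ∞) :
    ∃ μ : Fin H → PMF (X × A), ∀ π ∈ Pol, ∀ h z,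
      M.occ π h z ≤ ENNReal.ofReal ((M.cov Pol).toReal + 1) * μ h z := by
  have hlt : M.cov Pol < M.cov Pol + 1 := ENNReal.lt_add_right hcov one_ne_zero
  obtain ⟨μ, hμ⟩ := iInf_lt_iff.1 hlt
  refine ⟨μ, fun π hπ h z => le_mul_of_ratio_le (PMF.apply_ne_top _ _) ENNReal.ofReal_ne_top ?_⟩
  rw [ENNReal.ofReal_add ENNReal.toReal_nonneg zero_le_one, ENNReal.ofReal_toReal hcov,
    ENNReal.ofReal_one]
  refine le_trans ?_ hμ.le
  exact (le_iSup (fun z => ratio (M.occ π h z) (μ h z)) z).trans <|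
    (le_iSup (fun h => ⨆ z, ratio (M.occ π h z) (μ h z)) h).trans <|
      le_iSup₂ (f := fun π (_ : π ∈ Pol) => ⨆ h, ⨆ z, ratio (M.occ π h z) (μ h z)) π hπ

lemma MDP.Concentrable.occ_le {πs : Policy H X A} {ν : Fin H → PMF (X × A)} {C : ℝ}
    (hC : M.Concentrable πs ν C) (h : Fin H) (z : X × A) :
    M.occ πs h z ≤ ENNReal.ofReal C * ν h z :=
  le_mul_of_ratio_le (PMF.apply_ne_top _ _) ENNReal.ofReal_ne_top (hC h z)

lemma MDP.Concentrable.one_le {πs : Policy H X A} {ν : Fin H → PMF (X × A)} {C : ℝ}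
    (hC : M.Concentrable πs ν C) (hH : 0 < H) : 1 ≤ C := by
  rw [← ENNReal.one_le_ofReal, ← M.tsum_occ πs ⟨0, hH⟩]
  refine (ENNReal.tsum_le_tsum (hC.occ_le ⟨0, hH⟩)).trans ?_
  rw [ENNReal.tsum_mul_left, PMF.tsum_coe, mul_one]

end Coverage

/-! ### The data of a round of the hybrid reduction -/

section Run

variable {X : Type u} {A : Type v} [Countable X] [MeasurableSpace X] [DiscreteMeasurableSpace X]
  [Countable A] [MeasurableSpace A] [DiscreteMeasurableSpace A] {H T : ℕ} {M : MDP H X A}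
  {alg : OfflineAlg H X A} {ν : Fin H → PMF (X × A)} {Ω : Type w} [mΩ : MeasurableSpace Ω]
  {Pr : Measure Ω} [IsProbabilityMeasure Pr] {off on : Fin T → Ω → Fin H → Sample X A}

/-- The information available after the first `k` samples of the data of round `t`: first the
offline samples and then the online episodes. -/
def runFiltration (hoff : ∀ t, Measurable (off t)) (hon : ∀ t, Measurable (on t)) (t : ℕ) :
    Filtration ℕ mΩ where
  seq k := (⨆ s ∈ {s : Fin T | s.val < k ∨ t ≤ k}, MeasurableSpace.comap (off s) inferInstance) ⊔
    ⨆ s ∈ {s : Fin T | t + s.val < k}, MeasurableSpace.comap (on s) inferInstance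
  mono' k _ hkl := sup_le_sup
    (biSup_mono fun s (hs : s.val < k ∨ t ≤ k) => hs.imp (fun h => h.trans_le hkl) fun h => h.trans hkl)
    (biSup_mono fun s (hs : t + s.val < k) => hs.trans_le hkl)
  le' _ := sup_le (iSup₂_le fun s _ => (hoff s).comap_le) (iSup₂_le fun s _ => (hon s).comap_le)

/-- From index `t` on, all `T` offline samples are revealed, including those not used in round `t`.
The online phase thus has exactly the σ-algebra on which the run is conditioned. -/
lemma runFiltration_eq_comap (hoff : ∀ t, Measurable (off t)) (hon : ∀ t, Measurable (on t))
    {t : ℕ} (i : Fin T) :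
    runFiltration hoff hon t (t + i) = MeasurableSpace.comap
      (fun ω => ((fun s => off s ω), (fun s : {s : Fin T // s < i} => on s ω))) inferInstance := by
  have h1 : MeasurableSpace.comap (fun ω => ((fun s => off s ω),
      (fun s : {s : Fin T // s < i} => on s ω))) inferInstance =
      (⨆ s, MeasurableSpace.comap (off s) inferInstance) ⊔
      ⨆ s : {s : Fin T // s < i}, MeasurableSpace.comap (on s) inferInstance := by
    refine (MeasurableSpace.comap_prodMk _ _).trans ?_
    congr 1
    · refine MeasurableSpace.comap_iSup.trans (iSup_congr fun s => ?_)
      exact MeasurableSpace.comap_comp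
    · refine MeasurableSpace.comap_iSup.trans (iSup_congr fun s => ?_)
      exact MeasurableSpace.comap_comp
  rw [h1, iSup_subtype]
  change (⨆ s ∈ {s : Fin T | s.val < t + i ∨ t ≤ t + i}, _) ⊔ (⨆ s ∈ {s : Fin T | t + s.val < t + i}, _) = _
  congr 1
  · simp
  · refine iSup_congr fun s => iSup_congr_Prop ?_ fun _ => rfl
    exact Nat.add_lt_add_iff_left

/-- The dataset of round `t` of the hybrid-to-offline reduction. -/
def roundData (off on : Fin T → Ω → Fin H → Sample X A) (t : Fin T) (i : Fin (t + t)) (ω : Ω) :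
    Fin H → Sample X A :=
  Fin.append (fun i : Fin t => off (Fin.castLE t.isLt.le i) ω)
    (fun i : Fin t => on (Fin.castLE t.isLt.le i) ω) i

/-- The data distributions of round `t` of the hybrid-to-offline reduction. -/
noncomputable def roundLaw (M : MDP H X A) (alg : OfflineAlg H X A) (ν : Fin H → PMF (X × A))
    (off on : Fin T → Ω → Fin H → Sample X A) (t : Fin T) (i : Fin (t + t)) (ω : Ω) :
    Fin H → PMF (X × A) :=
  Fin.append (fun _ : Fin t => ν)
    (fun i : Fin t => M.occPMF (h2oPolicy alg (fun s => off s ω) (fun s => on s ω)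
      (Fin.castLE t.isLt.le i))) i

/-- The data of a round of the hybrid-to-offline reduction are adaptive data. -/
lemma MDP.IsH2ORun.isAdaptiveData (hrun : M.IsH2ORun alg ν Pr off on) (t : Fin T) :
    M.IsAdaptiveData Pr (roundLaw M alg ν off on t) (roundData off on t) := by
  set ℱ := runFiltration hrun.measurable_off hrun.measurable_on t with hℱ
  have hle : ∀ (k : ℕ) (s : Fin T), s.val < k ∨ t.val ≤ k →
      MeasurableSpace.comap (off s) inferInstance ≤ ℱ k := fun k s hs =>
    le_sup_of_le_left (le_iSup₂ (f := fun (s : Fin T)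
      (_ : s ∈ {s : Fin T | s.val < k ∨ t.val ≤ k}) =>
        MeasurableSpace.comap (off s) inferInstance) s hs)
  have hle' : ∀ (k : ℕ) (s : Fin T), t.val + s.val < k →
      MeasurableSpace.comap (on s) inferInstance ≤ ℱ k := fun k s hs =>
    le_sup_of_le_right (le_iSup₂ (f := fun (s : Fin T)
      (_ : s ∈ {s : Fin T | t.val + s.val < k}) =>
        MeasurableSpace.comap (on s) inferInstance) s hs)
  refine ⟨ℱ, fun i => ?_, fun i => ?_⟩
  · refine Fin.addCases (fun j => ?_) (fun j => ?_) i
    · have e : roundData off on t (Fin.castAdd t j) = off (Fin.castLE t.isLt.le j) := by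
        funext ω
        simp [roundData]
      rw [e]
      exact (comap_measurable _).mono (hle _ _ (Or.inl (by simp))) le_rfl
    · have e : roundData off on t (Fin.natAdd t j) = on (Fin.castLE t.isLt.le j) :=
        funext fun ω => Fin.append_right _ _ j
      rw [e]
      exact (comap_measurable _).mono (hle' _ _ (Nat.lt_succ_self _)) le_rfl
  · refine Fin.addCases (fun j => ?_) (fun j => ?_) i
    · intro h S hS
      set i' := Fin.castLE t.isLt.le j with hi'
      have e : ∀ ω, roundData off on t (Fin.castAdd t j) ω = off i' ω := fun ω => by
        simp [roundData, hi']
      have e' : ∀ ω, roundLaw M alg ν off on t (Fin.castAdd t j) ω = ν := fun ω => by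
        simp [roundLaw]
      simp_rw [e, e']
      have hS' : MeasurableSet {τ : Fin H → Sample X A | τ h ∈ S} := measurable_pi_apply h hS
      -- In the offline phase only the earlier offline samples are known, so the current one is
      -- independent of the past.
      have hFeq : ℱ (Fin.castAdd t j : Fin (t + t)) =
          ⨆ s ∈ {s : Fin T | s.val < j.val}, MeasurableSpace.comap (off s) inferInstance := by
        have h1 : {s : Fin T | s.val < (Fin.castAdd t j : Fin (t + t)).val ∨
            t.val ≤ (Fin.castAdd t j : Fin (t + t)).val} = {s : Fin T | s.val < j.val} := by
          ext s
          have := j.isLt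
          simp
        have h2 : {s : Fin T | t.val + s.val < (Fin.castAdd t j : Fin (t + t)).val} = ∅ := by
          ext s
          have := j.isLt
          simp
          omega
        change (⨆ s ∈ {s : Fin T | s.val < (Fin.castAdd t j : Fin (t + t)).val ∨
            t.val ≤ (Fin.castAdd t j : Fin (t + t)).val}, _) ⊔
          (⨆ s ∈ {s : Fin T | t.val + s.val < (Fin.castAdd t j : Fin (t + t)).val}, _) = _
        rw [h1, h2]
        simp
      have hind : Indep (MeasurableSpace.comap (off i') inferInstance)
          (ℱ (Fin.castAdd t j : Fin (t + t))) Pr := by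
        rw [hFeq]
        have := indep_iSup_of_disjoint (fun s => (hrun.measurable_off s).comap_le) hrun.indep_off
          (S := {i'}) (T := {s : Fin T | s.val < j.val}) (by simp [hi'])
        simpa using this
      have hmS : MeasurableSet[MeasurableSpace.comap (off i') inferInstance]
          {ω | off i' ω h ∈ S} := ⟨_, hS', rfl⟩
      refine (condExp_indep_eq (hrun.measurable_off i').comap_le (ℱ.le _)
        ((@stronglyMeasurable_const _ _ (MeasurableSpace.comap (off i') inferInstance) _ _).indicator
          hmS) hind).trans (Filter.Eventually.of_forall fun ω => ?_)
      have hm : MeasurableSet {ω | off i' ω h ∈ S} := (hrun.measurable_off i').comap_le _ hmS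
      have hmap := hrun.law_off i' h
      have hmm : Measurable fun ω => off i' ω h :=
        (measurable_pi_apply h).comp (hrun.measurable_off i')
      simp only
      rw [integral_indicator hm, ← hmap, Measure.map_apply hmm hS]
      simp [measureReal_def]
      rfl
    · intro h S hS
      set i' := Fin.castLE t.isLt.le j with hi'
      have e : ∀ ω, roundData off on t (Fin.natAdd t j) ω = on i' ω := fun ω =>
        Fin.append_right _ _ j
      have e' : ∀ ω, roundLaw M alg ν off on t (Fin.natAdd t j) ω =
          M.occPMF (h2oPolicy alg (fun s => off s ω) (fun s => on s ω) i') := fun ω =>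
        Fin.append_right _ _ j
      simp_rw [e, e']
      have hS' : MeasurableSet {τ : Fin H → Sample X A | τ h ∈ S} := measurable_pi_apply h hS
      have hFeq := runFiltration_eq_comap hrun.measurable_off hrun.measurable_on (t := t) i'
      have hval : ((Fin.natAdd t j : Fin (t + t)) : ℕ) = t + i' := rfl
      rw [hval, hℱ, hFeq]
      refine (hrun.law_on i' _ hS').trans (Filter.Eventually.of_forall fun ω => ?_)
      simp only
      rw [← M.map_law_eval, Measure.map_apply (measurable_pi_apply h) hS]
      rfl

end Run

/-! ### Cumulative regret of the hybrid reduction -/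

section Hybrid

variable {X : Type u} {A : Type v} [Countable X] [MeasurableSpace X] [DiscreteMeasurableSpace X]
  [Countable A] [MeasurableSpace A] [DiscreteMeasurableSpace A] {H T : ℕ} {M : MDP H X A}
  {ν : Fin H → PMF (X × A)}

/-- The data distributions of round `t` as a function of the policies of the earlier rounds. -/
noncomputable def hybridLaw (M : MDP H X A) (ν : Fin H → PMF (X × A)) (π : Fin T → Policy H X A)
    (t : Fin T) : Fin (t + t) → Fin H → PMF (X × A) :=
  Fin.append (fun _ : Fin t => ν) (fun i : Fin t => M.occPMF (π (Fin.castLE t.isLt.le i)))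

lemma mixture_hybridLaw (π : Fin T → Policy H X A) (t : Fin T) (h : Fin H) (z : X × A) :
    mixture (hybridLaw M ν π t) h z =
      (t * ν h z + ∑ i : Fin t, M.occ (π (Fin.castLE t.isLt.le i)) h z) / (t + t : ℕ) := by
  rw [mixture, Fin.sum_univ_add]
  simp only [hybridLaw, Fin.append_left, Fin.append_right, Finset.sum_const, Finset.card_univ,
    Fintype.card_fin, nsmul_eq_mul, M.occPMF_apply]

/-- The offline half of the data controls the concentrability of the comparator. -/
lemma ccc_hybridLaw_le_of_concentrable {πs : Policy H X A} {C : ℝ} (hC0 : 0 ≤ C)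
    (hC : M.Concentrable πs ν C) (π : Fin T → Policy H X A) {t : Fin T} (ht : 0 < t.val)
    (h : Fin H) (c : ℝ) : ccc (M.occ πs h) (mixture (hybridLaw M ν π t) h) c ≤ 2 * C := by
  have htt : ((t + t : ℕ) : ℝ≥0∞) ≠ 0 := by exact_mod_cast (by omega : t.val + t.val ≠ 0)
  have hν : ∀ z, ν h z ≤ 2 * mixture (hybridLaw M ν π t) h z := by
    intro z
    rw [mixture_hybridLaw, ← mul_div_assoc,
      ENNReal.le_div_iff_mul_le (Or.inl htt) (Or.inl (ENNReal.natCast_ne_top _))]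
    rw [mul_add]
    refine le_add_right (le_of_eq ?_)
    push_cast
    ring
  rw [← ENNReal.ofReal_le_ofReal_iff (by positivity), ofReal_ccc (M.tsum_occ πs h)]
  calc _ ≤ ∑' z, M.occ πs h z * ENNReal.ofReal (2 * C) := by
        refine ENNReal.tsum_le_tsum fun z => (mul_le_mul_right (min_le_left _ _) _).trans
          (mul_ratio_le ((hC.occ_le h z).trans ?_))
        rw [mul_comm 2 C, ENNReal.ofReal_mul hC0, mul_assoc, ENNReal.ofReal_ofNat]
        exact mul_le_mul_right (hν z) _
    _ = _ := by rw [ENNReal.tsum_mul_right, M.tsum_occ, one_mul]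

lemma MDP.occ_ne_top (π : Policy H X A) (h : Fin H) (z : X × A) : M.occ π h z ≠ ∞ :=
  measure_ne_top _ _

/-- The clipped ratio of the current occupancy to the online half of the data. -/
lemma occ_mul_clipped_le {π : Fin T → Policy H X A} {t : Fin T} (ht : 0 < t.val) {h : Fin H}
    {z : X × A} {γ B S : ℝ} (hB : (M.occ (π t) h z).toReal ≤ B)
    (hS : ∑ i : Fin t, (M.occ (π (Fin.castLE t.isLt.le i)) h z).toReal = S) :
    M.occ (π t) h z * min (ratio (M.occ (π t) h z) (mixture (hybridLaw M ν π t) h z))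
        (ENNReal.ofReal (γ * (t + t : ℕ))) ≤
      ENNReal.ofReal ((t + t : ℕ) * if S < B then γ * (M.occ (π t) h z).toReal
        else (M.occ (π t) h z).toReal ^ 2 / S) := by
  set d := M.occ (π t) h z with hd
  have hdt : d ≠ ∞ := M.occ_ne_top _ _ _
  have hn : (0 : ℝ) < (t + t : ℕ) := by exact_mod_cast (by omega : 0 < t.val + t.val)
  have hd0 : 0 ≤ d.toReal := ENNReal.toReal_nonneg
  split_ifs with hlt
  · refine (mul_le_mul_right (min_le_right _ _) _).trans (le_of_eq ?_)
    rw [← ENNReal.ofReal_toReal hdt, ← ENNReal.ofReal_mul hd0]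
    congr 1
    rw [ENNReal.toReal_ofReal hd0]
    ring
  · push Not at hlt
    rcases hd0.eq_or_lt with h0 | hpos
    · have : d = 0 := ((ENNReal.toReal_eq_zero_iff _).1 h0.symm).resolve_right hdt
      rw [this, zero_mul]
      exact zero_le
    have hSpos : 0 < S := hpos.trans_le (hB.trans hlt)
    -- The offline half of the mixture is discarded.
    have hmix : ENNReal.ofReal (S / (t + t : ℕ)) ≤ mixture (hybridLaw M ν π t) h z := by
      rw [mixture_hybridLaw, ENNReal.ofReal_div_of_pos hn, ENNReal.ofReal_natCast, ← hS,
        ENNReal.ofReal_sum_of_nonneg fun i _ => ENNReal.toReal_nonneg]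
      simp_rw [fun i => ENNReal.ofReal_toReal (M.occ_ne_top (π i) h z)]
      exact ENNReal.div_le_div_right le_add_self _
    have hle : d ≤ ENNReal.ofReal ((t + t : ℕ) * (d.toReal / S)) *
        mixture (hybridLaw M ν π t) h z := by
      refine le_trans (le_of_eq ?_) (mul_le_mul_right hmix _)
      rw [← ENNReal.ofReal_mul (by positivity)]
      conv_lhs => rw [← ENNReal.ofReal_toReal hdt]
      congr 1
      field_simp
    refine (mul_le_mul_right (min_le_left _ _) _).trans ((mul_ratio_le hle).trans (le_of_eq ?_))
    conv_lhs => rw [← ENNReal.ofReal_toReal hdt]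
    rw [← ENNReal.ofReal_mul hd0, ENNReal.toReal_ofReal hd0]
    congr 1
    ring

/-- The clipped concentrability coefficients of the online policies add up to at most the
coverability coefficient, up to a logarithmic factor. -/
lemma sum_ccc_hybridLaw_le {C : ℝ} (hC0 : 0 ≤ C) {η : Fin H → PMF (X × A)}
    {π : Fin T → Policy H X A} (hη : ∀ t h z, M.occ (π t) h z ≤ ENNReal.ofReal C * η h z)
    (hT : 0 < T) {γ : ℝ} (hγ : 0 < γ) (h : Fin H) :
    ∑ t : Fin T, ccc (M.occ (π t) h) (mixture (hybridLaw M ν π t) h) (γ * (t + t : ℕ)) /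
      (t + t : ℕ) ≤ C * (2 * γ + 2 * Real.log T) := by
  have hlog : 0 ≤ Real.log T := Real.log_natCast_nonneg T
  -- Occupancies are continued by `0` beyond round `T`, so that the potential bound for sequences
  -- applies.
  let d : X × A → ℕ → ℝ := fun z k => if hk : k < T then (M.occ (π ⟨k, hk⟩) h z).toReal else 0
  let B : X × A → ℝ := fun z => C * (η h z).toReal
  have hB : ∀ z, 0 ≤ B z := fun z => mul_nonneg hC0 ENNReal.toReal_nonneg
  have hdt : ∀ z (t : Fin T), d z t = (M.occ (π t) h z).toReal := fun z t => dif_pos t.isLt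
  have hd : ∀ z k, d z k ∈ Set.Icc 0 (B z) := by
    intro z k
    by_cases hk : k < T
    · rw [hdt z ⟨k, hk⟩]
      refine ⟨ENNReal.toReal_nonneg, ?_⟩
      refine (ENNReal.toReal_mono (ENNReal.mul_ne_top ENNReal.ofReal_ne_top
        (PMF.apply_ne_top _ _)) (hη ⟨k, hk⟩ h z)).trans (le_of_eq ?_)
      rw [ENNReal.toReal_mul, ENNReal.toReal_ofReal hC0]
    · simp only [d, hk, dif_neg, not_false_iff]
      exact ⟨le_rfl, hB z⟩
  let p : X × A → ℕ → ℝ := fun z t => if ∑ s ∈ Finset.range t, d z s < B z then γ * d z t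
      else d z t ^ 2 / ∑ s ∈ Finset.range t, d z s
  have hp : ∀ z t, 0 ≤ p z t := by
    intro z t
    have h1 := (hd z t).1
    have h2 : 0 ≤ ∑ s ∈ Finset.range t, d z s := Finset.sum_nonneg fun s _ => (hd z s).1
    simp only [p]
    split_ifs <;> positivity
  have hQ : ∀ t : Fin T, ENNReal.ofReal
      (ccc (M.occ (π t) h) (mixture (hybridLaw M ν π t) h) (γ * (t + t : ℕ)) / (t + t : ℕ)) ≤
      ∑' z, ENNReal.ofReal (p z t) := by
    intro t
    rcases Nat.eq_zero_or_pos t.val with h0 | ht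
    · simp [h0]
    have hn : (0 : ℝ) < (t + t : ℕ) := by exact_mod_cast (by omega : 0 < t.val + t.val)
    rw [ENNReal.ofReal_div_of_pos hn, ofReal_ccc (M.tsum_occ _ h)]
    refine ENNReal.div_le_of_le_mul ?_
    rw [← ENNReal.tsum_mul_right]
    refine ENNReal.tsum_le_tsum fun z => ?_
    have hBz : (M.occ (π t) h z).toReal ≤ B z := hdt z t ▸ (hd z t).2
    have hS : ∑ i : Fin t, (M.occ (π (Fin.castLE t.isLt.le i)) h z).toReal =
        ∑ s ∈ Finset.range t, d z s := by
      rw [← Fin.sum_univ_eq_sum_range]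
      exact Finset.sum_congr rfl fun i _ => (hdt z (Fin.castLE t.isLt.le i)).symm
    refine (occ_mul_clipped_le ht hBz hS).trans (le_of_eq ?_)
    rw [mul_comm, ENNReal.ofReal_mul' hn.le]
    simp only [p, hdt]
  rw [← ENNReal.ofReal_le_ofReal_iff (by positivity),
    ENNReal.ofReal_sum_of_nonneg fun t _ => div_nonneg (ccc_nonneg _ _ _) (Nat.cast_nonneg _)]
  calc _ ≤ ∑ t : Fin T, ∑' z, ENNReal.ofReal (p z t) := Finset.sum_le_sum fun t _ => hQ t
    _ = ∑' z, ENNReal.ofReal (∑ t ∈ Finset.range T, p z t) := by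
        rw [← Summable.tsum_finsetSum fun _ _ => ENNReal.summable]
        refine tsum_congr fun z => ?_
        rw [Fin.sum_univ_eq_sum_range (fun t => ENNReal.ofReal (p z t)),
          ENNReal.ofReal_sum_of_nonneg fun t _ => hp z t]
    -- The potential bound at `z` is proportional to the cap `C η(z)`, and `η` has total mass one.
    _ ≤ ∑' z, ENNReal.ofReal (C * (2 * γ + 2 * Real.log T)) * η h z := by
        refine ENNReal.tsum_le_tsum fun z => ?_
        refine (ENNReal.ofReal_le_ofReal (sum_clipped_potential_le (hB z) hγ.le (hd z) hT)).trans
          (le_of_eq ?_)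
        conv_rhs => rw [← ENNReal.ofReal_toReal (PMF.apply_ne_top (η h) z)]
        rw [← ENNReal.ofReal_mul (by positivity)]
        congr 1
        ring
    _ = _ := by rw [ENNReal.tsum_mul_left, PMF.tsum_coe, mul_one]

lemma sum_inv_le_one_add_log (T : ℕ) :
    ∑ t : Fin T, ((t : ℕ) : ℝ)⁻¹ ≤ 1 + Real.log T := by
  rw [Fin.sum_univ_eq_sum_range (fun k => (k : ℝ)⁻¹)]
  refine le_trans ?_ (harmonic_le_one_add_log T)
  -- Round `0` contributes `0⁻¹ = 0`, which shifts the sum to a harmonic one.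
  rcases T with _ | T
  · simp
  rw [Finset.sum_range_succ']
  simp only [harmonic, Rat.cast_sum, Rat.cast_inv, Rat.cast_natCast, CharP.cast_eq_zero, inv_zero,
    add_zero]
  exact Finset.sum_le_sum_of_subset_of_nonneg (Finset.range_subset_range.2 (Nat.le_succ T))
    fun _ _ _ => by positivity

/-- The optimal choice of the scale balances the terms of the cumulative regret. -/
lemma risk_le_of_sum_le {H T K ℓ Λ ρ : ℝ} (hH : 1 ≤ H) (hT : 1 ≤ T) (hK : 1 ≤ K)
    (hℓ : 1 / 2 ≤ ℓ) (hΛ : 1 ≤ Λ) (hρ : ρ ≤ T)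
    (hsum : ∀ γ, 0 < γ → ρ ≤ 1 + H * (30 * K * Λ / γ + 24 * K + 3072 * Λ * ℓ * γ * T)) :
    ρ / T ≤ 4000 * Λ * (H * √(K * ℓ / T)) := by
  have hT0 : 0 < T := by linarith
  have hK0 : 0 < K := by linarith
  have hℓ0 : 0 < ℓ := by linarith
  have hΛ0 : 0 < Λ := by linarith
  set r := √(K * ℓ / T) with hr
  have hrsq : r ^ 2 = K * ℓ / T := Real.sq_sqrt (by positivity)
  have hr0 : 0 < r := Real.sqrt_pos.2 (by positivity)
  have hHΛ : 1 ≤ H * Λ := by nlinarith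
  rw [div_le_iff₀ hT0]
  -- For `T ≤ K` the root is at least `1/2` and the trivial bound `ρ ≤ T` is enough. Otherwise the
  -- scale `√(K ℓ / T) / ℓ` balances the two `γ`-dependent terms.
  rcases le_total T K with hTK | hKT
  · have h1 : 1 / 2 ≤ r ^ 2 := by
      rw [hrsq, le_div_iff₀ hT0]
      nlinarith
    have h2 : 1 / 2 ≤ r := by nlinarith
    have h3 : 1 / 2 ≤ H * Λ * r := by nlinarith
    nlinarith
  · have hγ : 0 < r / ℓ := by positivity
    have e1 : 30 * K * Λ / (r / ℓ) = 30 * Λ * r * T := by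
      have : K * ℓ = r ^ 2 * T := by rw [hrsq]; field_simp
      field_simp
      linear_combination this
    have e2 : 3072 * Λ * ℓ * (r / ℓ) * T = 3072 * Λ * r * T := by field_simp
    have h1 := hsum _ hγ
    rw [e1, e2] at h1
    -- With `T ≥ K` and `ℓ ≥ 1/2`, the terms free of `γ` are of no larger order; altogether `30 +
    -- 3072 + 48 + 2 ≤ 4000`.
    have h2 : K ≤ 2 * r * T := by
      refine abs_le_of_sq_le_sq' ?_ (by positivity) |>.2
      have : (2 * r * T) ^ 2 = 4 * (K * ℓ) * T := by
        rw [mul_pow, mul_pow, hrsq]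
        field_simp
        ring
      rw [this]
      nlinarith [mul_pos hK0 hT0, mul_le_mul_of_nonneg_left hKT hK0.le]
    have hrT : 0 < r * T := by positivity
    have h3 : 1 ≤ H * (2 * r * T) := by nlinarith
    have h4 : H * (2 * r * T) ≤ H * Λ * (2 * r * T) := by
      nlinarith [mul_pos hrT (by linarith : 0 < H)]
    have h5 : H * (24 * K) ≤ 24 * (H * (2 * r * T)) := by nlinarith
    nlinarith

/-- The risk bound of the hybrid-to-offline reduction, given the regret bounds of all rounds. -/
lemma sum_regret_le {πs : Policy H X A} {π : Fin T → Policy H X A} {Cstar Ccov ℓ L : ℝ}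
    (hnorm : M.Normalized) (hH : 0 < H) (hT : 0 < T) (hcov0 : 0 ≤ Ccov)
    (hconc : M.Concentrable πs ν Cstar) {η : Fin H → PMF (X × A)}
    (hη : ∀ t h z, M.occ (π t) h z ≤ ENNReal.ofReal (Ccov + 1) * η h z)
    (hℓ : 1 / 2 ≤ ℓ) (hL : L ≤ Real.log (2 * H) + ℓ)
    (hreg : ∀ t : Fin T, 0 < t.val → ∀ γ, 0 < γ → M.J πs - M.J (π t) ≤
      ∑ h, (6 / γ / (t + t : ℕ) *
        (ccc (M.occ πs h) (mixture (hybridLaw M ν π t) h) (γ * (t + t : ℕ)) +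
          ccc (M.occ (π t) h) (mixture (hybridLaw M ν π t) h) (γ * (t + t : ℕ))) +
        1024 * L * γ)) :
    (∑ t, (M.J πs - M.J (π t))) / T ≤
      4000 * Real.log (Real.exp 1 * H * T) * (H * √((Cstar + Ccov) * ℓ / T)) := by
  have hH1 : (1 : ℝ) ≤ H := by exact_mod_cast hH
  have hT1 : (1 : ℝ) ≤ T := by exact_mod_cast hT
  have hC1 := hconc.one_le hH
  have hlogH : 0 ≤ Real.log H := Real.log_nonneg hH1
  have hlogT : 0 ≤ Real.log T := Real.log_nonneg hT1
  have hΛe : Real.log (Real.exp 1 * H * T) = 1 + Real.log H + Real.log T := by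
    rw [Real.log_mul (by positivity) (by positivity), Real.log_mul (by positivity) (by positivity),
      Real.log_exp]
  have hone : ∀ t, M.J πs - M.J (π t) ≤ 1 := fun t => by
    linarith [(hnorm.J_mem_Icc πs).2, (hnorm.J_mem_Icc (π t)).1]
  set Λ := Real.log (Real.exp 1 * H * T) with hΛ
  have hΛ1 : 1 ≤ Λ := by linarith
  have hL3 : L ≤ 3 * Λ * ℓ := by
    have h2 : Real.log (2 * H) ≤ Λ := by
      rw [Real.log_mul (by norm_num) (by positivity), hΛe]
      linarith [Real.log_two_lt_d9]
    nlinarith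
  refine risk_le_of_sum_le hH1 hT1 (by linarith) hℓ hΛ1 ?_ fun γ hγ => ?_
  · refine (Finset.sum_le_sum fun t _ => hone t).trans ?_
    simp
  let Q : Fin T → Fin H → ℝ := fun t h =>
    ccc (M.occ (π t) h) (mixture (hybridLaw M ν π t) h) (γ * (t + t : ℕ)) / (t + t : ℕ)
  have hQ0 : ∀ t h, 0 ≤ Q t h := fun t h => div_nonneg (ccc_nonneg _ _ _) (Nat.cast_nonneg _)
  -- Round `0` has no data and is charged the trivial regret `1`.
  have hterm : ∀ t : Fin T, M.J πs - M.J (π t) ≤ (if t = ⟨0, hT⟩ then 1 else 0) +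
      ∑ h, (6 * Cstar / γ * ((t : ℕ) : ℝ)⁻¹ + 6 / γ * Q t h + 3072 * Λ * ℓ * γ) := by
    intro t
    rcases Nat.eq_zero_or_pos t.val with h0 | ht
    · rw [if_pos (Fin.ext h0)]
      refine (hone t).trans (le_add_of_nonneg_right (Finset.sum_nonneg fun h _ => ?_))
      have := hQ0 t h
      positivity
    · have ht' : (0 : ℝ) < t.val := by exact_mod_cast ht
      rw [if_neg (fun e => ht.ne' (congrArg Fin.val e)), zero_add]
      refine (hreg t ht γ hγ).trans (Finset.sum_le_sum fun h _ => ?_)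
      have h1 := ccc_hybridLaw_le_of_concentrable (by linarith) hconc π ht h (γ * (t + t : ℕ))
      have h2 : 6 / γ / (t + t : ℕ) *
          ccc (M.occ πs h) (mixture (hybridLaw M ν π t) h) (γ * (t + t : ℕ)) ≤
          6 * Cstar / γ * ((t : ℕ) : ℝ)⁻¹ := by
        refine (mul_le_mul_of_nonneg_left h1 (by positivity)).trans (le_of_eq ?_)
        push_cast
        field_simp
        norm_num
      have h3 : 6 / γ / (t + t : ℕ) *
          ccc (M.occ (π t) h) (mixture (hybridLaw M ν π t) h) (γ * (t + t : ℕ)) =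
          6 / γ * Q t h := by
        simp only [Q]
        ring
      have h4 : 1024 * L * γ ≤ 3072 * Λ * ℓ * γ := by nlinarith
      rw [mul_add]
      linarith
  have hsumQ : ∀ h, ∑ t, Q t h ≤ (Ccov + 1) * (2 * γ + 2 * Real.log T) := fun h =>
    sum_ccc_hybridLaw_le (by linarith) hη hT hγ h
  have hinv := sum_inv_le_one_add_log T
  refine (Finset.sum_le_sum fun t _ => hterm t).trans ?_
  rw [Finset.sum_add_distrib, Finset.sum_comm]
  refine add_le_add (by simp) ?_
  have hcol : ∀ h : Fin H, ∑ t : Fin T, (6 * Cstar / γ * ((t : ℕ) : ℝ)⁻¹ + 6 / γ * Q t h +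
      3072 * Λ * ℓ * γ) ≤ 30 * (Cstar + Ccov) * Λ / γ + 24 * (Cstar + Ccov) +
        3072 * Λ * ℓ * γ * T := by
    intro h
    rw [Finset.sum_add_distrib, Finset.sum_add_distrib, ← Finset.mul_sum, ← Finset.mul_sum]
    have h1 : 6 * Cstar / γ * ∑ t : Fin T, ((t : ℕ) : ℝ)⁻¹ ≤ 6 * Cstar / γ * Λ :=
      mul_le_mul_of_nonneg_left (by linarith) (by positivity)
    have h2 : 6 / γ * ∑ t, Q t h ≤ 6 / γ * ((Ccov + 1) * (2 * γ + 2 * Λ)) := by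
      refine mul_le_mul_of_nonneg_left ((hsumQ h).trans ?_) (by positivity)
      exact mul_le_mul_of_nonneg_left (by linarith) (by positivity)
    have h3 : 6 / γ * ((Ccov + 1) * (2 * γ + 2 * Λ)) =
        12 * (Ccov + 1) + 12 * ((Ccov + 1) * (Λ / γ)) := by
      field_simp
      ring
    have h4 : 6 * Cstar / γ * Λ = 6 * (Cstar * (Λ / γ)) := by ring
    have h5 : 30 * (Cstar + Ccov) * Λ / γ = 30 * (Cstar * (Λ / γ)) + 30 * (Ccov * (Λ / γ)) := by
      ring
    have hx : 0 ≤ Λ / γ := by positivity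
    have h6 : Λ / γ ≤ Cstar * (Λ / γ) := le_mul_of_one_le_left hx hC1
    have h7 : 0 ≤ Ccov * (Λ / γ) := mul_nonneg hcov0 hx
    have h8 : ∑ _t : Fin T, 3072 * Λ * ℓ * γ = 3072 * Λ * ℓ * γ * T := by
      simp [mul_comm]
    rw [h8]
    have h9 : (Ccov + 1) * (Λ / γ) = Ccov * (Λ / γ) + Λ / γ := by ring
    rw [h9] at h3
    linarith
  refine (Finset.sum_le_sum fun h _ => hcol h).trans (le_of_eq ?_)
  rw [Finset.sum_const, Finset.card_univ, Fintype.card_fin, nsmul_eq_mul]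

end Hybrid

/-! ### The high-probability risk bound -/

section Risk

variable {X : Type u} {A : Type v} [Countable X] [MeasurableSpace X] [DiscreteMeasurableSpace X]
  [Countable A] [MeasurableSpace A] [DiscreteMeasurableSpace A] {H T : ℕ} {M : MDP H X A}
  {F : Finset (QFun H X A)} {sel : QFun H X A → Fin H → X → A} {alg : OfflineAlg H X A}
  {ν : Fin H → PMF (X × A)} {πs : Policy H X A} {Cstar δ : ℝ} {Ω : Type w} [MeasurableSpace Ω]
  {Pr : Measure Ω} [IsProbabilityMeasure Pr] {off on : Fin T → Ω → Fin H → Sample X A}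

/-- A Bellman complete class with a single element consists of the optimal value function. -/
lemma J_le_of_card_eq_one (hF : ∀ f ∈ F, ∀ h x a, f h x a ∈ Set.Icc (0 : ℝ) 1)
    (hsel : IsGreedySelector F sel) (hM : BellmanComplete F M) (hcard : F.card = 1) (hH : 0 < H)
    {π' : Policy H X A} (hπ' : π' ∈ policyClass F sel) (π : Policy H X A) :
    M.J π - M.J π' ≤ 0 := by
  obtain ⟨f, hf, rfl⟩ := hπ'
  have hA : Nonempty A := by
    obtain ⟨x, -⟩ := M.init.support_nonempty
    exact ⟨sel f ⟨0, hH⟩ x⟩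
  obtain ⟨f₀, rfl⟩ := Finset.card_eq_one.1 hcard
  refine (M.J_sub_le_sum_bellman_error (hf.mem_Icc hF) (hsel f hf) π).trans (le_of_eq ?_)
  refine Finset.sum_eq_zero fun h _ => ?_
  obtain ⟨g, hg, e⟩ := hM.exists_bellman_eq (Finset.singleton_nonempty _) hf h
  obtain ⟨g', hg', e'⟩ := hf h
  rw [Finset.mem_singleton] at hg hg'
  rw [← e, ← e', hg, hg']
  simp

lemma log_two_mul_min_le {n : ℕ} (hn : 0 < n) (hH : 0 < H) (hne : F.Nonempty) (hδ : 0 < δ) :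
    Real.log (2 * (min n H : ℕ) * F.card / δ) ≤
      Real.log (2 * H) + Real.log (F.card / δ) := by
  have hH' : (0 : ℝ) < H := by exact_mod_cast hH
  have hc : (0 : ℝ) < F.card := by exact_mod_cast hne.card_pos
  have hm : (0 : ℝ) < (min n H : ℕ) := by exact_mod_cast lt_min hn hH
  rw [← Real.log_mul (by positivity) (by positivity), mul_div_assoc]
  refine Real.log_le_log (by positivity) ?_
  gcongr
  exact min_le_right n H

/-- The risk bound for the hybrid-to-offline reduction with Fitted Q-Iteration. -/
theorem h2oRisk_fqi_le (hne : F.Nonempty) (hF : ∀ f ∈ F, ∀ h x a, f h x a ∈ Set.Icc (0 : ℝ) 1)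
    (hsel : IsGreedySelector F sel) (halg : IsFQI F sel alg) (hδ : 0 < δ) (hδ1 : δ < 1)
    (hT : 0 < T) (hnorm : M.Normalized) (hopt : M.IsOptimal πs) (hM : BellmanComplete F M)
    (hconc : M.Concentrable πs ν Cstar) (hrun : M.IsH2ORun alg ν Pr off on) :
    Pr {ω | ¬ M.h2oRisk πs alg (fun t => off t ω) (fun t => on t ω) ≤
        4000 * Real.log (Real.exp 1 * H * T) ^ 1 *
          (H * √((Cstar + (M.cov (policyClass F sel)).toReal) * Real.log (F.card / δ) / T))}
      ≤ ENNReal.ofReal (δ * T) := by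
  have hCC := ccBounded_fqi.{u, v, w} hne hF hsel halg hδ hδ1
  have hPol : ∀ ω t, h2oPolicy alg (fun s => off s ω) (fun s => on s ω) t ∈ policyClass F sel :=
    fun ω t => hCC.1 _ _
  have hT1 : (1 : ℝ) ≤ T := by exact_mod_cast hT
  rcases Nat.eq_zero_or_pos H with rfl | hH
  · simp [MDP.h2oRisk, MDP.J]
  have hH1 : (1 : ℝ) ≤ H := by exact_mod_cast hH
  -- For a singleton class `log (|F| / δ)` tends to `0` as `δ → 1`, so the balancing argument is
  -- unavailable; there the regret is nonpositive. With two elements the logarithm is at least `log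
  -- 2 ≥ 1/2`.
  rcases (Nat.succ_le_of_lt hne.card_pos).eq_or_lt with hcard | hcard
  · refine le_of_eq_of_le (measure_mono_null (t := ∅) ?_ measure_empty) zero_le
    intro ω hω
    refine hω ?_
    have h1 : M.h2oRisk πs alg (fun t => off t ω) (fun t => on t ω) ≤ 0 :=
      div_nonpos_of_nonpos_of_nonneg (Finset.sum_nonpos fun t _ =>
        J_le_of_card_eq_one hF hsel hM hcard.symm hH (hPol ω t) πs) (Nat.cast_nonneg _)
    refine h1.trans ?_
    have h2 : 0 ≤ Real.log (Real.exp 1 * H * T) := by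
      refine Real.log_nonneg ?_
      have := Real.one_le_exp zero_le_one
      calc (1 : ℝ) ≤ H := hH1
        _ ≤ Real.exp 1 * H := le_mul_of_one_le_left (by linarith) this
        _ ≤ _ := le_mul_of_one_le_right (by positivity) hT1
    positivity
  have hℓ : 1 / 2 ≤ Real.log (F.card / δ) := by
    have hc : (2 : ℝ) ≤ F.card := by exact_mod_cast hcard
    have h2 : (2 : ℝ) ≤ F.card / δ := by
      rw [le_div_iff₀ hδ]
      nlinarith
    have := Real.log_le_log (by norm_num) h2
    linarith [Real.log_two_gt_d9]
  have hPne : (policyClass F sel).Nonempty := by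
    obtain ⟨f, hf⟩ := hne
    exact ⟨_, f, fun h => ⟨f, hf, rfl⟩, rfl⟩
  -- Finiteness of the coverability matters: `toReal` would turn an infinite value into `0`.
  obtain ⟨η, hη⟩ := M.exists_covering (M.cov_ne_top (policyClass_finite F sel) hPne)
  let E : Fin T → Set Ω := fun t => {ω | ¬ ∀ γ ∈ Set.Ioi (0 : ℝ),
    M.J πs - M.J (alg (t + t) fun i => roundData off on t i ω) ≤
      ∑ h, (6 / γ / (t + t : ℕ) *
        (ccc (M.occ πs h) (mixture (fun i => roundLaw M alg ν off on t i ω) h) (γ * (t + t : ℕ)) +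
          ccc (M.occ (alg (t + t) fun i => roundData off on t i ω) h)
            (mixture (fun i => roundLaw M alg ν off on t i ω) h) (γ * (t + t : ℕ))) +
        1024 * Real.log (2 * (min (t + t : ℕ) H : ℕ) * F.card / δ) * γ)}
  have hE : ∀ t ∈ Finset.univ.filter (fun t : Fin T => 0 < t.val),
      Pr (E t) ≤ ENNReal.ofReal δ := by
    intro t ht
    have ht' : 0 < t.val := (Finset.mem_filter.1 ht).2
    exact hCC.2 M πs hnorm hopt Ω Pr (t + t) (roundLaw M alg ν off on t) (roundData off on t)
      (by omega) (hrun.isAdaptiveData t) (Filter.Eventually.of_forall fun _ => hM)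
  calc _ ≤ Pr (⋃ t ∈ Finset.univ.filter (fun t : Fin T => 0 < t.val), E t) := by
        refine measure_mono fun ω hω => ?_
        by_contra hgood
        refine hω ?_
        rw [pow_one]
        refine sum_regret_le (π := fun t => h2oPolicy alg (fun s => off s ω) (fun s => on s ω) t)
          hnorm hH hT ENNReal.toReal_nonneg hconc (fun t h z => hη _ (hPol ω t) h z) hℓ
          le_rfl ?_
        intro t ht γ hγ
        have hmem : ω ∉ E t := fun hmem => hgood (Set.mem_biUnion (by simpa using ht) hmem)
        simp only [E, Set.mem_ofPred_eq, not_not] at hmem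
        refine (hmem γ hγ).trans (Finset.sum_le_sum fun h _ => add_le_add le_rfl ?_)
        have := log_two_mul_min_le (n := t.val + t.val) (by omega) hH hne hδ
        gcongr
    _ ≤ ∑ t ∈ Finset.univ.filter (fun t : Fin T => 0 < t.val), Pr (E t) :=
        measure_biUnion_finset_le _ _
    _ ≤ ∑ t ∈ Finset.univ.filter (fun t : Fin T => 0 < t.val), ENNReal.ofReal δ :=
        Finset.sum_le_sum hE
    _ ≤ ∑ _t : Fin T, ENNReal.ofReal δ :=
        Finset.sum_le_sum_of_subset (Finset.filter_subset _ _)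
    _ = ENNReal.ofReal (δ * T) := by
        rw [Finset.sum_const, Finset.card_univ, Fintype.card_fin, nsmul_eq_mul, mul_comm,
          ENNReal.ofReal_mul hδ.le, ENNReal.ofReal_natCast]

end Risk

end HybridRL

theorem mainTheorem6 :
    -- Fitted Q-Iteration is CC-bounded for all scales simultaneously
    (∀ (H : ℕ) (X : Type u) (A : Type v) [Countable X] [MeasurableSpace X]
        [DiscreteMeasurableSpace X] [Countable A] [MeasurableSpace A] [DiscreteMeasurableSpace A]
        (F : Finset (QFun H X A)) (sel : QFun H X A → Fin H → X → A) (alg : OfflineAlg H X A)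
        (δ : ℝ),
      F.Nonempty → (∀ f ∈ F, ∀ h x a, f h x a ∈ Set.Icc (0 : ℝ) 1) →
      IsGreedySelector F sel → IsFQI F sel alg → 0 < δ → δ < 1 →
      CCBounded.{u, v, w} alg (policyClass F sel) (fun _ M => BellmanComplete F M) (Set.Ioi 0)
        (fun γ => 6 / γ)
        (fun n γ => 1024 * Real.log (2 * (min n H : ℕ) * F.card / δ) * γ) δ) ∧
    -- the risk bound for the hybrid-to-offline reduction
    (∃ (C : ℝ) (k : ℕ), ∀ (H T : ℕ) (X : Type u) (A : Type v) [Countable X] [MeasurableSpace X]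
        [DiscreteMeasurableSpace X] [Countable A] [MeasurableSpace A] [DiscreteMeasurableSpace A]
        (F : Finset (QFun H X A)) (sel : QFun H X A → Fin H → X → A) (alg : OfflineAlg H X A)
        (M : MDP H X A) (πs : Policy H X A) (ν : Fin H → PMF (X × A)) (Cstar δ : ℝ)
        (Ω : Type w) [MeasurableSpace Ω] (Pr : Measure Ω) [IsProbabilityMeasure Pr]
        (off on : Fin T → Ω → Fin H → Sample X A),
      F.Nonempty → (∀ f ∈ F, ∀ h x a, f h x a ∈ Set.Icc (0 : ℝ) 1) →
      IsGreedySelector F sel → IsFQI F sel alg → 0 < δ → δ < 1 → 0 < T →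
      M.Normalized → M.IsOptimal πs → BellmanComplete F M → M.Concentrable πs ν Cstar →
      M.IsH2ORun alg ν Pr off on →
      Pr {ω | ¬ M.h2oRisk πs alg (fun t => off t ω) (fun t => on t ω) ≤
          C * Real.log (Real.exp 1 * H * T) ^ k *
            (H * √((Cstar + (M.cov (policyClass F sel)).toReal) *
              Real.log (F.card / δ) / T))}
        ≤ ENNReal.ofReal (δ * T)) := by
  refine ⟨fun H X A _ _ _ _ _ _ F sel alg δ hne hF hsel halg hδ hδ1 =>
    ccBounded_fqi hne hF hsel halg hδ hδ1, 4000, 1, ?_⟩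
  intro H T X A _ _ _ _ _ _ F sel alg M πs ν Cstar δ Ω _ Pr _ off on hne hF hsel halg hδ hδ1 hT
    hnorm hopt hM hconc hrun
  exact h2oRisk_fqi_le hne hF hsel halg hδ hδ1 hT hnorm hopt hM hconc hrun
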